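/- For $x\in\mathbb R$ let $T_xf(t)=f(t-x)$ and $E_xf(t)=e^{2\pi i x t}f(t)$ on $L^2(\mathbb R)$ (complex-valued functions, Lebesgue measure). For $g\in L^2(\mathbb R)$, the system $(g,1,1)=(E_mT_ng)_{m,n\in\mathbb Z}$ is called a WH-frame if there are constants $A,B>0$ with $$A\|f\|^2\le\sum_{m,n\in\mathbb Z}|\langle f,E_mT_ng\rangle|^2\le B\|f\|^2\qquad\text{for all } f\in L^2(\mathbb R).$$ For $k\in\mathbb Z$ put $G_k(t)=\sum_{n\in\mathbb Z}g(t-n)\overline{g(t-n-k)}$. There is $g\in L^2(\mathbb R)$ such that $(g,1,1)$ is a WH-frame and the following hold. For every $k\in\mathbb Z$ the series defining $G_k(t)$ converges absolutely for almost every $t$, and for every $f\in L^2(\mathbb R)$ and $k\in\mathbb Z$ the function $t\mapsto\overline{f(t)}f(t-k)G_k(t)$ is integrable. For every $f\in L^2(\mathbb R)$, $$\lim_{K,L\to\infty}\ \sum_{k=-L}^{K}\int_{\mathbb R}\overline{f(t)}\,f(t-k)\,G_k(t)\,dt=\sum_{m,n\in\mathbb Z}|\langle f,E_mT_ng\rangle|^2,$$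 where $K$ and $L$ tend to infinity independently. However, there is $h\in L^2(\mathbb R)$ for which the series $$\sum_{k\in\mathbb Z}\int_{\mathbb R}\overline{h(t)}\,h(t-k)\,G_k(t)\,dt$$ does not converge unconditionally. -/

import Mathlib

open MeasureTheory Filter Topology

noncomputable section

namespace WeylHeisenberg

/-- The complex Hilbert space `L²(ℝ)` with respect to Lebesgue measure. -/
abbrev L2 : Type := Lp ℂ 2 (volume : Measure ℝ)

/-- A family `(e i)` in a complex Hilbert space is a frame: there are `A, B > 0` with
`A ‖f‖² ≤ ∑ |⟨f, e i⟩|² ≤ B ‖f‖²` for all `f`, the sum being finite.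
(Mathlib's inner product is linear in the second variable.) -/
def IsFrame {ι H : Type*} [NormedAddCommGroup H] [InnerProductSpace ℂ H] (e : ι → H) : Prop :=
  ∃ A B : ℝ, 0 < A ∧ 0 < B ∧ ∀ f : H,
    Summable (fun i => ‖inner ℂ (e i) f‖ ^ 2) ∧
    A * ‖f‖ ^ 2 ≤ ∑' i, ‖inner ℂ (e i) f‖ ^ 2 ∧
    ∑' i, ‖inner ℂ (e i) f‖ ^ 2 ≤ B * ‖f‖ ^ 2

/-- Translation `(T_a f)(x) = f (x - a)` on `L²(ℝ)`. -/
def translation (a : ℝ) (f : L2) : L2 :=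
  Lp.compMeasurePreserving (fun x : ℝ => x - a) (measurePreserving_sub_right volume a) f

theorem memLp_modulation (b : ℝ) (f : L2) :
    MemLp (fun x : ℝ => Complex.exp (2 * Real.pi * Complex.I * b * x) * f x) 2 volume := by
  refine (Lp.memLp f).of_le ?_ (Eventually.of_forall fun x => ?_)
  · exact (Continuous.aestronglyMeasurable (by fun_prop)).mul (Lp.aestronglyMeasurable f)
  · have h : (2 * Real.pi * Complex.I * b * x : ℂ)
        = ((2 * Real.pi * b * x : ℝ) : ℂ) * Complex.I := by
      push_cast; ring
    rw [norm_mul, h, Complex.norm_exp_ofReal_mul_I, one_mul]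

/-- Modulation `(E_b f)(x) = e^{2 π i b x} f x` on `L²(ℝ)`. -/
def modulation (b : ℝ) (f : L2) : L2 := (memLp_modulation b f).toLp

/-- The Weyl-Heisenberg system `(g, a, b) = (E_{mb} T_{na} g)`, indexed by `(m, n) ∈ ℤ × ℤ`. -/
def whSystem (g : L2) (a b : ℝ) (p : ℤ × ℤ) : L2 :=
  modulation (p.1 * b) (translation (p.2 * a) g)

/-- `(g, a, b)` is a Weyl-Heisenberg frame for `L²(ℝ)`. -/
def IsWHFrame (g : L2) (a b : ℝ) : Prop := IsFrame (whSystem g a b)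

/-- The summand `g (t - n a) * conj (g (t - n a - k / b))` of `G_k t`. -/
def GTerm (g : L2) (a b : ℝ) (k : ℤ) (t : ℝ) (n : ℤ) : ℂ :=
  g (t - n * a) * (starRingEnd ℂ) (g (t - n * a - k / b))

/-- `G_k t = ∑ n, g (t - n a) * conj (g (t - n a - k / b))`. -/
def G (g : L2) (a b : ℝ) (k : ℤ) (t : ℝ) : ℂ := ∑' n : ℤ, GTerm g a b k t n

/-- The integrand `conj (f t) * f (t - k / b) * G_k t`. -/
def identityIntegrand (g : L2) (a b : ℝ) (f : L2) (k : ℤ) (t : ℝ) : ℂ :=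
  (starRingEnd ℂ) (f t) * f (t - k / b) * G g a b k t

/-- The left side `∑_{m,n} |⟨f, E_{mb} T_{na} g⟩|²` of the WH-frame identity. -/
def identityLHS (g : L2) (a b : ℝ) (f : L2) : ℝ :=
  ∑' p : ℤ × ℤ, ‖inner ℂ (whSystem g a b p) f‖ ^ 2

/-- The `k`-th term `(1/b) ∫ conj (f t) f (t - k / b) G_k t dt` of the series on the right side
of the WH-frame identity. -/
def identityRHSTerm (g : L2) (a b : ℝ) (f : L2) (k : ℤ) : ℂ :=
  (1 / b : ℂ) * ∫ t : ℝ, identityIntegrand g a b f k t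

end WeylHeisenberg

end

/-! Cut the line into countably many pieces invariant under integer translation: up to a null set,
the `j`-th piece is where the fractional part lies in `(1/(j+2), 1/(j+1))`. On it let the window be
constant on each translate of the unit interval, with values the coefficients of a polynomial `γ_j =
2 + q_j`. Integer translations and modulations preserve the pieces, so the problem splits: with `V`
the unit translation, `f_j` the part of `f` on the `j`-th piece and `r_j` the autocorrelation of
`γ_j`, the `k`-th term of the series is `∑_j r_j(k) ⟨f_j, V^k f_j⟩`.

Take `q_j(z) = (9/16)^j z^(2^j) P_j(z)` with `P_j` the Rudin-Shapiro polynomial of length `N = 2^j`.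
Three features of `P_j` matter: its coefficients are `±1`, its sup norm and those of its partial
sums are `O(√N)`, and its autocorrelation has `ℓ¹` norm `O(N^(3/2))`. Hence `q_j(V)` has norm at
most `3/2`, so `γ_j(V)` is bounded above and below and the window generates a frame
(`isWHFrame_window`). Moreover `r_j = 4 + 2 q_j + 2 q_j* + q_j q_j*`, where interval sums of the
middle terms are bounded and the last term is bounded in `ℓ¹`, uniformly in `j`. So interval partial
sums are at most `31 ‖f_j‖²` (`norm_sum_Icc_autocorr_le`), and dominated convergence over `j` gives
the identity.

For the failure of unconditional convergence, the last term contributes an absolutely summable error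
(`summable_error`). For `2^i ≤ k < 2^(i+1)` what remains is `2 q_i(k) ⟨h_i, V^k h_i⟩`. If `h_i` is
almost invariant under these shifts and `‖h_i‖² = (8/9)^i`, each such term is at least `(9/16)^i
(8/9)^i = 2^(-i)` in modulus, and there are `2^i` of them: every dyadic block has absolute sum at
least `1`. The ratio `9/16` has to exceed `1/2`, so that the weights `8/9` are summable, and to
satisfy `8 (9/16)^4 ≤ 1`, so that the `ℓ¹` bound is uniform.

Norms of `p(V)` replace sup norms on the circle throughout. -/

open LaurentPolynomial

noncomputable section

namespace WeylHeisenberg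

/-! ### Laurent polynomials in a group of isometries -/

section LaurentOp

variable {H : Type*} [NormedAddCommGroup H] [InnerProductSpace ℂ H]

/-- The operator `∑ p_k V_k` attached to a real Laurent polynomial `p` and a representation `V`
of `ℤ` by operators. -/
def laurentOp (V : Multiplicative ℤ →* (H →L[ℂ] H)) : ℝ[T;T⁻¹] →+* (H →L[ℂ] H) :=
  AddMonoidAlgebra.liftNCRingHom ((algebraMap ℂ (H →L[ℂ] H)).comp Complex.ofRealHom) V
    (fun x _ => Algebra.commutes (x : ℂ) _)

variable (V : Multiplicative ℤ →* (H →L[ℂ] H))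

theorem laurentOp_single (n : ℤ) (a : ℝ) :
    laurentOp V (.single n a) = algebraMap ℂ (H →L[ℂ] H) a * V (.ofAdd n) :=
  AddMonoidAlgebra.liftNCRingHom_single _ _ _ _ _

theorem laurentOp_T (n : ℤ) : laurentOp V (T n) = V (.ofAdd n) := by
  rw [T, laurentOp_single, Complex.ofReal_one, map_one, one_mul]

theorem laurentOp_C (a : ℝ) (x : H) : laurentOp V (C a) x = (a : ℂ) • x := by
  rw [← single_eq_C, laurentOp_single, ofAdd_zero, map_one, mul_one]
  rfl

theorem laurentOp_apply {p : ℝ[T;T⁻¹]} {S : Finset ℤ} (hS : p.coeff.support ⊆ S) (x : H) :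
    laurentOp V p x = ∑ k ∈ S, (p.coeff k : ℂ) • V (.ofAdd k) x := by
  conv_lhs => rw [← AddMonoidAlgebra.sum_coeff_single p]
  rw [Finsupp.sum_of_support_subset _ hS _ (by simp), map_sum, _root_.sum_apply]
  refine Finset.sum_congr rfl fun k _ => ?_
  rw [single_eq_C_mul_T, map_mul, laurentOp_T, mul_apply_eq_comp, laurentOp_C]

theorem coeff_T_mul (n : ℤ) (p : ℝ[T;T⁻¹]) (k : ℤ) : (T n * p).coeff k = p.coeff (k - n) := by
  rw [T, AddMonoidAlgebra.coeff_single_mul_eq_mul_coeff (k - n), one_mul]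
  intro m _
  omega

/-- The part of a Laurent polynomial of degree less than `m`. -/
def lowPart (m : ℤ) (p : ℝ[T;T⁻¹]) : ℝ[T;T⁻¹] := .ofCoeff (p.coeff.filter (· < m))

theorem lowPart_coeff (m : ℤ) (p : ℝ[T;T⁻¹]) (k : ℤ) :
    (lowPart m p).coeff k = if k < m then p.coeff k else 0 := by
  simp [lowPart, Finsupp.filter_apply]

theorem lowPart_add (m : ℤ) (p q : ℝ[T;T⁻¹]) :
    lowPart m (p + q) = lowPart m p + lowPart m q := by
  ext k; simp only [lowPart_coeff, AddMonoidAlgebra.coeff_add, Finsupp.add_apply]; split_ifs <;> simp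

theorem lowPart_sub (m : ℤ) (p q : ℝ[T;T⁻¹]) :
    lowPart m (p - q) = lowPart m p - lowPart m q := by
  ext k; simp only [lowPart_coeff, AddMonoidAlgebra.coeff_sub, Finsupp.sub_apply]; split_ifs <;> simp

theorem coeff_one (k : ℤ) : (1 : ℝ[T;T⁻¹]).coeff k = if k = 0 then 1 else 0 := by
  rw [← map_one C, C_apply]

theorem coeff_C_mul (a : ℝ) (p : ℝ[T;T⁻¹]) (k : ℤ) : (C a * p).coeff k = a * p.coeff k := by
  rw [← smul_eq_C_mul, AddMonoidAlgebra.coeff_smul_apply, smul_eq_mul]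

theorem lowPart_C_mul (m : ℤ) (a : ℝ) (p : ℝ[T;T⁻¹]) :
    lowPart m (C a * p) = C a * lowPart m p := by
  ext k; simp only [lowPart_coeff, coeff_C_mul]; split_ifs <;> simp

theorem lowPart_T_mul (m n : ℤ) (p : ℝ[T;T⁻¹]) :
    lowPart m (T n * p) = T n * lowPart (m - n) p := by
  ext k; simp only [lowPart_coeff, coeff_T_mul, sub_lt_sub_iff_right]

theorem lowPart_eq_self {m : ℤ} {p : ℝ[T;T⁻¹]} (h : ∀ k, m ≤ k → p.coeff k = 0) :
    lowPart m p = p := by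
  ext k; rw [lowPart_coeff]; split_ifs with hk
  · rfl
  · rw [h k (by omega)]

theorem lowPart_eq_zero {m : ℤ} {p : ℝ[T;T⁻¹]} (h : ∀ k, k < m → p.coeff k = 0) :
    lowPart m p = 0 := by
  ext k; rw [lowPart_coeff]; split_ifs with hk
  · rw [h k hk]; rfl
  · rfl

theorem norm_laurentOp_C_mul (a : ℝ) (p : ℝ[T;T⁻¹]) (x : H) :
    ‖laurentOp V (C a * p) x‖ = |a| * ‖laurentOp V p x‖ := by
  rw [map_mul, mul_apply_eq_comp, laurentOp_C, norm_smul, Complex.norm_real,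
    Real.norm_eq_abs]

theorem norm_sq_laurentOp_of_orthonormal (p : ℝ[T;T⁻¹]) {e : H}
    (he : Orthonormal ℂ fun k : ℤ => V (.ofAdd k) e) {S : Finset ℤ} (hS : p.coeff.support ⊆ S) :
    ‖laurentOp V p e‖ ^ 2 = ∑ k ∈ S, p.coeff k ^ 2 := by
  rw [laurentOp_apply V hS, ← Complex.ofReal_inj]
  have h := he.inner_sum (fun k => (p.coeff k : ℂ)) (fun k => (p.coeff k : ℂ)) S
  rw [inner_self_eq_norm_sq_to_K] at h
  push_cast
  refine h.trans (Finset.sum_congr rfl fun k _ => ?_)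
  rw [Complex.conj_ofReal, sq]

variable {V} (hV : ∀ n x, ‖V n x‖ = ‖x‖)
include hV

theorem inner_rep_left (n : ℤ) (x y : H) :
    inner ℂ (V (.ofAdd n) x) y = inner ℂ x (V (.ofAdd (-n)) y) := by
  have h : V (.ofAdd n) (V (.ofAdd (-n)) y) = y := by
    rw [← mul_apply_eq_comp, ← map_mul, ← ofAdd_add]; simp
  conv_lhs => rw [← h]
  exact LinearIsometry.inner_map_map ⟨(V (.ofAdd n)).toLinearMap, hV _⟩ _ _

/-- An isometric representation of a group is unitary, so the adjoint of `V^n` is `V^(-n)`; real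
coefficients are unaffected by conjugation. -/
theorem inner_laurentOp_left (p : ℝ[T;T⁻¹]) (x y : H) :
    inner ℂ (laurentOp V p x) y = inner ℂ x (laurentOp V (invert p) y) := by
  induction p using LaurentPolynomial.induction_on' with
  | add p q hp hq =>
    simp only [map_add, _root_.add_apply, inner_add_left, inner_add_right, hp, hq]
  | C_mul_T n a =>
    simp only [map_mul, invert_C, invert_T, mul_apply_eq_comp, laurentOp_C,
      laurentOp_T, inner_smul_left, inner_smul_right, Complex.conj_ofReal, inner_rep_left hV]

theorem norm_sq_laurentOp_invert (p : ℝ[T;T⁻¹]) (x : H) :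
    ((‖laurentOp V (invert p) x‖ ^ 2 : ℝ) : ℂ) = inner ℂ x (laurentOp V (p * invert p) x) := by
  have h := inner_laurentOp_left hV (invert p) x (laurentOp V (invert p) x)
  rw [inner_self_eq_norm_sq_to_K, involutive_invert p, ← mul_apply_eq_comp,
    ← map_mul] at h
  rw [← h]; push_cast; rfl

/-- Laurent polynomials commute, so the operator is normal and has the same norms as its adjoint. -/
theorem norm_laurentOp_invert (p : ℝ[T;T⁻¹]) (x : H) :
    ‖laurentOp V (invert p) x‖ = ‖laurentOp V p x‖ := by
  have h1 := norm_sq_laurentOp_invert hV p x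
  have h2 := norm_sq_laurentOp_invert hV (invert p) x
  rw [involutive_invert p, mul_comm, ← h1] at h2
  have h3 := Complex.ofReal_injective h2
  exact ((pow_left_inj₀ (norm_nonneg _) (norm_nonneg _) two_ne_zero).1 h3).symm

end LaurentOp

/-! ### Rudin-Shapiro polynomials -/

/-- The Rudin-Shapiro pairs of polynomials. -/
def rudinShapiro : ℕ → ℝ[T;T⁻¹] × ℝ[T;T⁻¹]
  | 0 => (1, 1)
  | j + 1 => ((rudinShapiro j).1 + T (2 ^ j) * (rudinShapiro j).2,
      (rudinShapiro j).1 - T (2 ^ j) * (rudinShapiro j).2)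

theorem rudinShapiro_coeff_eq_zero (j : ℕ) (k : ℤ) (hk : k < 0 ∨ 2 ^ j ≤ k) :
    (rudinShapiro j).1.coeff k = 0 ∧ (rudinShapiro j).2.coeff k = 0 := by
  induction j generalizing k with
  | zero =>
    have : k ≠ 0 := by rintro rfl; simp at hk
    simp [rudinShapiro, coeff_one, this]
  | succ j ih =>
    have h2 : (0 : ℤ) < 2 ^ j := by positivity
    have h3 : (2 : ℤ) ^ (j + 1) = 2 ^ j + 2 ^ j := by ring
    simp only [rudinShapiro, AddMonoidAlgebra.coeff_add, AddMonoidAlgebra.coeff_sub,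
      Finsupp.add_apply, Finsupp.sub_apply, coeff_T_mul]
    rw [(ih k (by omega)).1, (ih (k - 2 ^ j) (by omega)).2]; simp

theorem abs_rudinShapiro_coeff (j : ℕ) (k : ℤ) (h0 : 0 ≤ k) (hk : k < 2 ^ j) :
    |(rudinShapiro j).1.coeff k| = 1 ∧ |(rudinShapiro j).2.coeff k| = 1 := by
  induction j generalizing k with
  | zero =>
    have : k = 0 := by simp at hk; omega
    subst this
    simp [rudinShapiro]
  | succ j ih =>
    have h2 : (0 : ℤ) < 2 ^ j := by positivity
    have h3 : (2 : ℤ) ^ (j + 1) = 2 ^ j + 2 ^ j := by ring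
    simp only [rudinShapiro, AddMonoidAlgebra.coeff_add, AddMonoidAlgebra.coeff_sub,
      Finsupp.add_apply, Finsupp.sub_apply, coeff_T_mul]
    rcases lt_or_ge k (2 ^ j) with h | h
    · rw [(rudinShapiro_coeff_eq_zero j (k - 2 ^ j) (by omega)).2]
      simpa using (ih k h0 h).1
    · rw [(rudinShapiro_coeff_eq_zero j k (by omega)).1]
      simpa using (ih (k - 2 ^ j) (by omega) (by omega)).2

section RudinShapiroOp

variable {H : Type*} [NormedAddCommGroup H] [InnerProductSpace ℂ H]
variable {V : Multiplicative ℤ →* (H →L[ℂ] H)} (hV : ∀ n x, ‖V n x‖ = ‖x‖)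
include hV

theorem norm_laurentOp_T_mul (n : ℤ) (p : ℝ[T;T⁻¹]) (x : H) :
    ‖laurentOp V (T n * p) x‖ = ‖laurentOp V p x‖ := by
  rw [map_mul, mul_apply_eq_comp, laurentOp_T, hV]

/-- The operator form of `|P_j|² + |Q_j|² = 2^(j+1)` on the circle; the recursion is exactly the
parallelogram law. -/
theorem norm_sq_rudinShapiro (j : ℕ) (x : H) :
    ‖laurentOp V (rudinShapiro j).1 x‖ ^ 2 + ‖laurentOp V (rudinShapiro j).2 x‖ ^ 2 =
      2 * 2 ^ j * ‖x‖ ^ 2 := by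
  induction j with
  | zero => simp [rudinShapiro]; ring
  | succ j ih =>
    have h := parallelogram_law_with_norm ℂ (laurentOp V (rudinShapiro j).1 x)
      (laurentOp V (T (2 ^ j) * (rudinShapiro j).2) x)
    rw [norm_laurentOp_T_mul hV] at h
    simp only [rudinShapiro, map_add, map_sub, _root_.add_apply,
      _root_.sub_apply]
    rw [pow_succ (2 : ℝ) j]
    nlinarith

theorem norm_sq_rudinShapiro_le (j : ℕ) (x : H) :
    ‖laurentOp V (rudinShapiro j).1 x‖ ^ 2 ≤ 2 * 2 ^ j * ‖x‖ ^ 2 ∧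
    ‖laurentOp V (rudinShapiro j).2 x‖ ^ 2 ≤ 2 * 2 ^ j * ‖x‖ ^ 2 := by
  have h := norm_sq_rudinShapiro hV j x
  constructor <;> nlinarith [sq_nonneg ‖laurentOp V (rudinShapiro j).1 x‖,
    sq_nonneg ‖laurentOp V (rudinShapiro j).2 x‖]

/-- Here `√2` is relaxed to the rational `3/2`, which still leaves room: `(9/16)(3/2) < 1`. -/
theorem norm_rudinShapiro_le (j : ℕ) (x : H) :
    ‖laurentOp V (rudinShapiro j).1 x‖ ≤ 3 / 2 * (3 / 2) ^ j * ‖x‖ ∧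
    ‖laurentOp V (rudinShapiro j).2 x‖ ≤ 3 / 2 * (3 / 2) ^ j * ‖x‖ := by
  have key : 2 * 2 ^ j * ‖x‖ ^ 2 ≤ (3 / 2 * (3 / 2) ^ j * ‖x‖) ^ 2 := by
    rw [mul_pow, mul_pow, ← pow_mul, mul_comm j 2, pow_mul]
    gcongr <;> norm_num
  obtain ⟨h1, h2⟩ := norm_sq_rudinShapiro_le hV j x
  have hpos : 0 ≤ 3 / 2 * (3 / 2) ^ j * ‖x‖ := by positivity
  exact ⟨(sq_le_sq₀ (norm_nonneg _) hpos).1 (h1.trans key),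
    (sq_le_sq₀ (norm_nonneg _) hpos).1 (h2.trans key)⟩

/-- A cut falls either in the first half, where the second half disappears, or in the second half,
where the first half stays whole. In the latter case the bounds `3/2` and `3` add up to `3 · (3/2)`,
which is why the constant `3` closes the induction. -/
theorem norm_lowPart_rudinShapiro_le (j : ℕ) (m : ℤ) (x : H) :
    ‖laurentOp V (lowPart m (rudinShapiro j).1) x‖ ≤ 3 * (3 / 2) ^ j * ‖x‖ ∧
    ‖laurentOp V (lowPart m (rudinShapiro j).2) x‖ ≤ 3 * (3 / 2) ^ j * ‖x‖ := by
  induction j generalizing m with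
  | zero =>
    have h : ‖laurentOp V (lowPart m 1) x‖ ≤ 3 * ‖x‖ := by
      rcases le_or_gt m 0 with hm | hm
      · rw [lowPart_eq_zero]
        · simp
        · intro k hk; rw [coeff_one, if_neg (by omega)]
      · rw [lowPart_eq_self]
        · simp; linarith [norm_nonneg x]
        · intro k hk; rw [coeff_one, if_neg (by omega)]
    simpa [rudinShapiro] using h
  | succ j ih =>
    simp only [rudinShapiro, lowPart_add, lowPart_sub, map_add, map_sub,
      _root_.add_apply, _root_.sub_apply, lowPart_T_mul]
    have hx : 0 ≤ (3 / 2 : ℝ) ^ j * ‖x‖ := by positivity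
    rcases le_or_gt m (2 ^ j) with hm | hm
    · rw [lowPart_eq_zero (p := (rudinShapiro j).2)
        fun k hk => (rudinShapiro_coeff_eq_zero j k (by omega)).2]
      simp only [mul_zero, map_zero, _root_.zero_apply, add_zero, sub_zero, and_self]
      refine (ih m).1.trans ?_
      rw [pow_succ]; nlinarith
    · rw [lowPart_eq_self (p := (rudinShapiro j).1)
        fun k hk => (rudinShapiro_coeff_eq_zero j k (by omega)).1]
      have h1 := (norm_rudinShapiro_le hV j x).1
      have h2 := (ih (m - 2 ^ j)).2
      rw [← norm_laurentOp_T_mul hV (2 ^ j)] at h2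
      rw [pow_succ]
      exact ⟨(norm_add_le _ _).trans (by linarith), (norm_sub_le _ _).trans (by linarith)⟩

/-- The autocorrelation coefficients of a Rudin-Shapiro polynomial are small in `ℓ¹`. -/
theorem sum_abs_autocorrelation_le {e : H} (he : Orthonormal ℂ fun k : ℤ => V (.ofAdd k) e)
    (j : ℕ) (S : Finset ℤ) :
    (∑ k ∈ S, |((rudinShapiro j).1 * invert (rudinShapiro j).1).coeff k|) ^ 2 ≤ 8 * 8 ^ j := by
  set P := (rudinShapiro j).1 with hP
  set r := P * invert P with hr
  have hN : (0 : ℤ) < 2 ^ j := by positivity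
  have hsupp : r.coeff.support ⊆ Finset.Ioo (-2 ^ j) (2 ^ j) := by
    intro k hk
    rw [Finsupp.mem_support_iff] at hk
    by_contra hk'
    apply hk
    classical
    rw [hr, AddMonoidAlgebra.coeff_mul]
    refine Finset.sum_eq_zero fun a ha => Finset.sum_eq_zero fun b hb => if_neg ?_
    rw [Finsupp.mem_support_iff] at ha hb
    rw [invert_apply] at hb
    have h1 : ¬ (a < 0 ∨ 2 ^ j ≤ a) := fun h => ha (rudinShapiro_coeff_eq_zero j a h).1
    have h2 : ¬ (-b < 0 ∨ 2 ^ j ≤ -b) := fun h => hb (rudinShapiro_coeff_eq_zero j _ h).1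
    rw [Finset.mem_Ioo] at hk'
    omega
  have he1 : ‖e‖ = 1 := by simpa using he.1 0
  -- Orthonormality of the orbit of `e` turns the `ℓ²` norm of the coefficients into the norm of
  -- `P(V) P(V)* e`. The `ℓ¹` bound then follows by Cauchy-Schwarz on fewer than `2 · 2^j` degrees.
  have hsq : ∑ k ∈ Finset.Ioo (-2 ^ j : ℤ) (2 ^ j), r.coeff k ^ 2 ≤ 2 * 2 ^ j * (2 * 2 ^ j) := by
    rw [← norm_sq_laurentOp_of_orthonormal V r he hsupp, hr, map_mul,
      mul_apply_eq_comp]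
    refine (norm_sq_rudinShapiro_le hV j _).1.trans ?_
    rw [norm_laurentOp_invert hV]
    have := (norm_sq_rudinShapiro_le hV j e).1
    rw [he1, one_pow, mul_one] at this
    gcongr
  have hle : ∑ k ∈ S, |r.coeff k| ≤ ∑ k ∈ Finset.Ioo (-2 ^ j : ℤ) (2 ^ j), |r.coeff k| := by
    classical
    rw [← Finset.sum_filter_add_sum_filter_not S (· ∈ Finset.Ioo (-2 ^ j : ℤ) (2 ^ j)),
      Finset.sum_eq_zero (s := S.filter (· ∉ Finset.Ioo (-2 ^ j : ℤ) (2 ^ j))), add_zero]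
    · refine Finset.sum_le_sum_of_subset_of_nonneg ?_ fun _ _ _ => abs_nonneg _
      intro k hk; exact (Finset.mem_filter.1 hk).2
    · intro k hk
      rw [abs_eq_zero]
      by_contra h
      exact (Finset.mem_filter.1 hk).2 (hsupp (Finsupp.mem_support_iff.2 h))
  have hcard : ((Finset.Ioo (-2 ^ j : ℤ) (2 ^ j)).card : ℝ) ≤ 2 * 2 ^ j := by
    rw [Int.card_Ioo]
    have : (((2 : ℤ) ^ j - -2 ^ j - 1).toNat : ℤ) ≤ 2 * 2 ^ j := by omega
    exact_mod_cast this
  calc (∑ k ∈ S, |r.coeff k|) ^ 2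
      ≤ (∑ k ∈ Finset.Ioo (-2 ^ j : ℤ) (2 ^ j), |r.coeff k|) ^ 2 := by
        gcongr
    _ ≤ (Finset.Ioo (-2 ^ j : ℤ) (2 ^ j)).card * ∑ k ∈ Finset.Ioo (-2 ^ j : ℤ) (2 ^ j),
        |r.coeff k| ^ 2 := sq_sum_le_card_mul_sum_sq
    _ ≤ (2 * 2 ^ j) * (2 * 2 ^ j * (2 * 2 ^ j)) := by
        simp only [sq_abs]
        gcongr
    _ = 8 * 8 ^ j := by
        rw [show (8 : ℝ) ^ j = 2 ^ j * 2 ^ j * 2 ^ j by rw [← mul_pow, ← mul_pow]; norm_num]; ring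

end RudinShapiroOp

/-! ### The generating polynomials -/

/-- The Rudin-Shapiro polynomial of length `2 ^ j`, shifted to the degrees `[2 ^ j, 2 ^ (j + 1))`
and scaled. -/
def shiftedBlock (j : ℕ) : ℝ[T;T⁻¹] := C ((9 / 16) ^ j) * (T (2 ^ j) * (rudinShapiro j).1)

/-- The coefficients of the window on the `j`-th piece of the line. -/
def generator (j : ℕ) : ℝ[T;T⁻¹] := C 2 + shiftedBlock j

/-- The autocorrelation of `generator j`. -/
def autocorr (j : ℕ) : ℝ[T;T⁻¹] := generator j * invert (generator j)

/-- The autocorrelation coefficients of `shiftedBlock j`. -/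
def blockAutocorr (j : ℕ) : ℝ[T;T⁻¹] := shiftedBlock j * invert (shiftedBlock j)

theorem shiftedBlock_coeff (j : ℕ) (k : ℤ) :
    (shiftedBlock j).coeff k = (9 / 16) ^ j * (rudinShapiro j).1.coeff (k - 2 ^ j) := by
  rw [shiftedBlock, coeff_C_mul, coeff_T_mul]

theorem shiftedBlock_coeff_eq_zero (j : ℕ) (k : ℤ) (hk : k < 2 ^ j ∨ 2 ^ (j + 1) ≤ k) :
    (shiftedBlock j).coeff k = 0 := by
  have h3 : (2 : ℤ) ^ (j + 1) = 2 ^ j + 2 ^ j := by ring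
  rw [shiftedBlock_coeff, (rudinShapiro_coeff_eq_zero j _ (by omega)).1, mul_zero]

theorem abs_shiftedBlock_coeff (j : ℕ) (k : ℤ) (h : 2 ^ j ≤ k) (h' : k < 2 ^ (j + 1)) :
    |(shiftedBlock j).coeff k| = (9 / 16) ^ j := by
  have h3 : (2 : ℤ) ^ (j + 1) = 2 ^ j + 2 ^ j := by ring
  rw [shiftedBlock_coeff, abs_mul, (abs_rudinShapiro_coeff j _ (by omega) (by omega)).1, mul_one,
    abs_of_pos (by positivity)]

theorem abs_shiftedBlock_coeff_le (j : ℕ) (k : ℤ) : |(shiftedBlock j).coeff k| ≤ 1 := by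
  by_cases h : k < 2 ^ j ∨ 2 ^ (j + 1) ≤ k
  · rw [shiftedBlock_coeff_eq_zero j k h]; simp
  · rw [abs_shiftedBlock_coeff j k (by omega) (by omega)]
    exact pow_le_one₀ (by norm_num) (by norm_num)

theorem autocorr_eq (j : ℕ) : autocorr j =
    C 4 + C 2 * shiftedBlock j + C 2 * invert (shiftedBlock j) + blockAutocorr j := by
  have h : (C 4 : ℝ[T;T⁻¹]) = C 2 * C 2 := by rw [← map_mul]; norm_num
  rw [autocorr, generator, map_add, invert_C, blockAutocorr, h]
  ring

theorem autocorr_coeff (j : ℕ) (k : ℤ) : (autocorr j).coeff k =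
    (if k = 0 then 4 else 0) + 2 * (shiftedBlock j).coeff k + 2 * (shiftedBlock j).coeff (-k) +
      (blockAutocorr j).coeff k := by
  rw [autocorr_eq]
  simp only [AddMonoidAlgebra.coeff_add, Finsupp.add_apply, C_apply, coeff_C_mul, invert_apply]

theorem autocorr_coeff_eq_sum (j : ℕ) (k : ℤ) : (autocorr j).coeff k =
    ∑ n ∈ (generator j).coeff.support, (generator j).coeff n * (generator j).coeff (n - k) := by
  classical
  rw [autocorr, AddMonoidAlgebra.coeff_mul, Finsupp.sum]
  refine Finset.sum_congr rfl fun n _ => ?_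
  rw [Finsupp.sum, Finset.sum_eq_single (k - n)]
  · rw [if_pos (by omega), invert_apply, neg_sub]
  · intro b _ hb; rw [if_neg (by omega)]
  · intro hb
    rw [Finsupp.notMem_support_iff] at hb
    rw [hb]; simp

/-- Autocorrelation does not see the shift by `2^j`, only the scaling, which enters squared. -/
theorem blockAutocorr_eq (j : ℕ) : blockAutocorr j =
    C (((9 / 16) ^ j) ^ 2) * ((rudinShapiro j).1 * invert (rudinShapiro j).1) := by
  rw [blockAutocorr, shiftedBlock, map_mul, map_mul, invert_C, invert_T, sq, map_mul]
  have h : (T (2 ^ j) : ℝ[T;T⁻¹]) * T (-2 ^ j) = 1 := by rw [← T_add, add_neg_cancel, T_zero]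
  linear_combination (C ((9 / 16) ^ j) * C ((9 / 16) ^ j) * (rudinShapiro j).1 *
    invert (rudinShapiro j).1) * h

section Bounds

variable {H : Type*} [NormedAddCommGroup H] [InnerProductSpace ℂ H]
variable {V : Multiplicative ℤ →* (H →L[ℂ] H)} (hV : ∀ n x, ‖V n x‖ = ‖x‖)
include hV

theorem norm_shiftedBlock_le (j : ℕ) (x : H) : ‖laurentOp V (shiftedBlock j) x‖ ≤ 3 / 2 * ‖x‖ := by
  rw [shiftedBlock, norm_laurentOp_C_mul, norm_laurentOp_T_mul hV, abs_of_pos (by positivity)]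
  have h := (norm_rudinShapiro_le hV j x).1
  have h1 : ((9 : ℝ) / 16) ^ j * (3 / 2) ^ j ≤ 1 := by
    rw [← mul_pow]; exact pow_le_one₀ (by norm_num) (by norm_num)
  calc _ ≤ (9 / 16 : ℝ) ^ j * (3 / 2 * (3 / 2) ^ j * ‖x‖) := by gcongr
    _ = ((9 / 16) ^ j * (3 / 2) ^ j) * (3 / 2 * ‖x‖) := by ring
    _ ≤ 1 * (3 / 2 * ‖x‖) := by gcongr
    _ = _ := one_mul _

theorem norm_generator_le (j : ℕ) (x : H) : ‖laurentOp V (generator j) x‖ ≤ 4 * ‖x‖ := by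
  have h := norm_shiftedBlock_le hV j x
  rw [generator, map_add, _root_.add_apply, laurentOp_C]
  refine (norm_add_le _ _).trans ?_
  rw [norm_smul]; norm_num; linarith [norm_nonneg x]

/-- The constant term `2` dominates the block, whose norm is at most `3/2`. -/
theorem le_norm_generator (j : ℕ) (x : H) : 1 / 2 * ‖x‖ ≤ ‖laurentOp V (generator j) x‖ := by
  have h := norm_shiftedBlock_le hV j x
  rw [generator, map_add, _root_.add_apply, laurentOp_C]
  have h2 := norm_sub_le_norm_add (((2 : ℝ) : ℂ) • x) (laurentOp V (shiftedBlock j) x)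
  rw [norm_smul] at h2
  norm_num at h2 ⊢
  linarith

theorem norm_lowPart_shiftedBlock_le (j : ℕ) (m : ℤ) (x : H) :
    ‖laurentOp V (lowPart m (shiftedBlock j)) x‖ ≤ 3 * ‖x‖ := by
  rw [shiftedBlock, lowPart_C_mul, lowPart_T_mul, norm_laurentOp_C_mul, norm_laurentOp_T_mul hV,
    abs_of_pos (by positivity)]
  have h := (norm_lowPart_rudinShapiro_le hV j (m - 2 ^ j) x).1
  have h1 : ((9 : ℝ) / 16) ^ j * (3 / 2) ^ j ≤ 1 := by
    rw [← mul_pow]; exact pow_le_one₀ (by norm_num) (by norm_num)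
  calc _ ≤ (9 / 16 : ℝ) ^ j * (3 * (3 / 2) ^ j * ‖x‖) := by gcongr
    _ = ((9 / 16) ^ j * (3 / 2) ^ j) * (3 * ‖x‖) := by ring
    _ ≤ 1 * (3 * ‖x‖) := by gcongr
    _ = _ := one_mul _

theorem norm_sum_Icc_shiftedBlock_le (j : ℕ) (a b : ℤ) (x : H) :
    ‖∑ k ∈ Finset.Icc a b, ((shiftedBlock j).coeff k : ℂ) * inner ℂ x (V (.ofAdd k) x)‖ ≤
      6 * ‖x‖ ^ 2 := by
  rcases lt_or_ge b a with hab | hab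
  · rw [Finset.Icc_eq_empty (by omega)]; simp
  -- An interval sum is a difference of two truncations, each of norm at most `3`; `lowPart` uses a
  -- strict inequality, hence the cut at `b + 1`.
  have key : ∑ k ∈ Finset.Icc a b, ((shiftedBlock j).coeff k : ℂ) * inner ℂ x (V (.ofAdd k) x) =
      inner ℂ x (laurentOp V (lowPart (b + 1) (shiftedBlock j) - lowPart a (shiftedBlock j)) x) := by
    have hS : (lowPart (b + 1) (shiftedBlock j) - lowPart a (shiftedBlock j)).coeff.support ⊆
        Finset.Icc a b := by
      intro k hk
      rw [Finsupp.mem_support_iff] at hk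
      by_contra h
      apply hk
      rw [Finset.mem_Icc] at h
      simp only [AddMonoidAlgebra.coeff_sub, Finsupp.sub_apply, lowPart_coeff]
      split_ifs <;> first | omega | simp
    rw [laurentOp_apply V hS, inner_sum]
    refine Finset.sum_congr rfl fun k hk => ?_
    rw [Finset.mem_Icc] at hk
    rw [inner_smul_right]
    simp only [AddMonoidAlgebra.coeff_sub, Finsupp.sub_apply, lowPart_coeff]
    rw [if_pos (by omega), if_neg (by omega), sub_zero]
  rw [key]
  refine (norm_inner_le_norm _ _).trans ?_
  rw [map_sub, _root_.sub_apply]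
  have h1 := norm_lowPart_shiftedBlock_le hV j (b + 1) x
  have h2 := norm_lowPart_shiftedBlock_le hV j a x
  have h3 := norm_sub_le (laurentOp V (lowPart (b + 1) (shiftedBlock j)) x)
    (laurentOp V (lowPart a (shiftedBlock j)) x)
  calc _ ≤ ‖x‖ * (6 * ‖x‖) := by gcongr; linarith
    _ = _ := by ring

/-- Conjugation together with `k ↦ -k` reduces this to the previous bound. -/
theorem norm_sum_Icc_shiftedBlock_neg_le (j : ℕ) (a b : ℤ) (x : H) :
    ‖∑ k ∈ Finset.Icc a b, ((shiftedBlock j).coeff (-k) : ℂ) * inner ℂ x (V (.ofAdd k) x)‖ ≤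
      6 * ‖x‖ ^ 2 := by
  rw [← RCLike.norm_conj, map_sum]
  have h : ∑ k ∈ Finset.Icc a b, (starRingEnd ℂ)
      (((shiftedBlock j).coeff (-k) : ℂ) * inner ℂ x (V (.ofAdd k) x)) =
      ∑ k ∈ Finset.Icc (-b) (-a), ((shiftedBlock j).coeff k : ℂ) * inner ℂ x (V (.ofAdd k) x) := by
    refine Finset.sum_nbij' (fun k => -k) (fun k => -k) ?_ ?_ (by simp) (by simp) ?_
    · intro k hk; rw [Finset.mem_Icc] at *; omega
    · intro k hk; rw [Finset.mem_Icc] at *; omega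
    · intro k _
      rw [map_mul, Complex.conj_ofReal, inner_conj_symm, inner_rep_left hV]
  rw [h]
  exact norm_sum_Icc_shiftedBlock_le hV j _ _ x

theorem sum_autocorr_mul_inner (j : ℕ) (x : H) {S : Finset ℤ} (hS : (autocorr j).coeff.support ⊆ S) :
    ∑ k ∈ S, ((autocorr j).coeff k : ℂ) * inner ℂ x (V (.ofAdd k) x) =
      ((‖laurentOp V (invert (generator j)) x‖ ^ 2 : ℝ) : ℂ) := by
  rw [norm_sq_laurentOp_invert hV, ← autocorr, laurentOp_apply V hS, inner_sum]
  simp_rw [inner_smul_right]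

variable {e : H} (he : Orthonormal ℂ fun k : ℤ => V (.ofAdd k) e)
include he

/-- The squared `ℓ¹` norm is at most `8 · (8 (9/16)^4)^j ≤ 8 < 9`. -/
theorem sum_abs_blockAutocorr_le (j : ℕ) (S : Finset ℤ) :
    ∑ k ∈ S, |(blockAutocorr j).coeff k| ≤ 3 := by
  simp_rw [blockAutocorr_eq, coeff_C_mul, abs_mul, ← Finset.mul_sum]
  refine abs_le_of_sq_le_sq' ?_ (by norm_num) |>.2
  rw [mul_pow, sq_abs]
  have h := sum_abs_autocorrelation_le hV he j S
  calc _ ≤ ((((9 : ℝ) / 16) ^ j) ^ 2) ^ 2 * (8 * 8 ^ j) := by gcongr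
    _ = 8 * (((9 : ℝ) / 16) ^ 4 * 8) ^ j := by
      rw [mul_pow, ← pow_mul _ 4 j]; ring
    _ ≤ 8 * 1 := by
      gcongr
      exact pow_le_one₀ (by norm_num) (by norm_num)
    _ ≤ _ := by norm_num

theorem abs_autocorr_coeff_le (j : ℕ) (k : ℤ) : |(autocorr j).coeff k| ≤ 11 := by
  rw [autocorr_coeff]
  have h1 := abs_shiftedBlock_coeff_le j k
  have h2 := abs_shiftedBlock_coeff_le j (-k)
  have h3 := sum_abs_blockAutocorr_le hV he j {k}
  rw [Finset.sum_singleton] at h3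
  rw [abs_le] at *
  split_ifs <;> constructor <;> linarith

/-- The four parts of the autocorrelation contribute `4 + 2 · 6 + 2 · 6 + 3`. Only the two middle
parts need an interval; they have no bound over arbitrary finite sets that is uniform in `j`. -/
theorem norm_sum_Icc_autocorr_le (j : ℕ) (a b : ℤ) (x : H) :
    ‖∑ k ∈ Finset.Icc a b, ((autocorr j).coeff k : ℂ) * inner ℂ x (V (.ofAdd k) x)‖ ≤
      31 * ‖x‖ ^ 2 := by
  have hin : ∀ k, ‖inner ℂ x (V k x)‖ ≤ ‖x‖ ^ 2 := fun k =>
    (norm_inner_le_norm _ _).trans (by rw [hV, sq])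
  have h1 := norm_sum_Icc_shiftedBlock_le hV j a b x
  have h2 := norm_sum_Icc_shiftedBlock_neg_le hV j a b x
  have h3 : ‖∑ k ∈ Finset.Icc a b, ((blockAutocorr j).coeff k : ℂ) * inner ℂ x (V (.ofAdd k) x)‖ ≤
      3 * ‖x‖ ^ 2 := by
    refine (norm_sum_le _ _).trans ?_
    refine le_trans ?_ (mul_le_mul_of_nonneg_right
      (sum_abs_blockAutocorr_le hV he j (Finset.Icc a b)) (sq_nonneg _))
    rw [Finset.sum_mul]
    refine Finset.sum_le_sum fun k _ => ?_
    rw [norm_mul, Complex.norm_real, Real.norm_eq_abs]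
    gcongr
    exact hin _
  have h4 : ‖∑ k ∈ Finset.Icc a b, (if k = 0 then (4 : ℂ) else 0) * inner ℂ x (V (.ofAdd k) x)‖ ≤
      4 * ‖x‖ ^ 2 := by
    simp_rw [ite_mul, zero_mul]
    rw [Finset.sum_ite_eq']
    split_ifs
    · rw [norm_mul, Complex.norm_ofNat]; gcongr; exact hin _
    · simp
  have hsum : ∑ k ∈ Finset.Icc a b, ((autocorr j).coeff k : ℂ) * inner ℂ x (V (.ofAdd k) x) =
      ∑ k ∈ Finset.Icc a b, (if k = 0 then (4 : ℂ) else 0) * inner ℂ x (V (.ofAdd k) x) +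
      2 * ∑ k ∈ Finset.Icc a b, ((shiftedBlock j).coeff k : ℂ) * inner ℂ x (V (.ofAdd k) x) +
      2 * ∑ k ∈ Finset.Icc a b, ((shiftedBlock j).coeff (-k) : ℂ) * inner ℂ x (V (.ofAdd k) x) +
      ∑ k ∈ Finset.Icc a b, ((blockAutocorr j).coeff k : ℂ) * inner ℂ x (V (.ofAdd k) x) := by
    simp_rw [Finset.mul_sum, ← Finset.sum_add_distrib]
    refine Finset.sum_congr rfl fun k _ => ?_
    rw [autocorr_coeff]
    split_ifs <;> push_cast <;> ring
  rw [hsum]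
  refine (norm_add_le _ _).trans ?_
  refine (add_le_add_left (norm_add₃_le) _).trans ?_
  rw [norm_mul, norm_mul, Complex.norm_ofNat]
  linarith

end Bounds

/-! ### Integer translations and multiplication operators on `L²(ℝ)` -/

theorem coeFn_translation (a : ℝ) (f : L2) : translation a f =ᵐ[volume] fun t => f (t - a) :=
  Lp.coeFn_compMeasurePreserving f (measurePreserving_sub_right volume a)

theorem ae_sub {p : ℝ → Prop} (h : ∀ᵐ t : ℝ, p t) (a : ℝ) : ∀ᵐ t : ℝ, p (t - a) :=
  (measurePreserving_sub_right volume a).quasiMeasurePreserving.ae h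

theorem translation_zero (f : L2) : translation 0 f = f := by
  apply Lp.ext
  filter_upwards [coeFn_translation 0 f] with t ht
  rw [ht, sub_zero]

theorem translation_add (a b : ℝ) (f : L2) :
    translation (a + b) f = translation a (translation b f) := by
  apply Lp.ext
  filter_upwards [coeFn_translation (a + b) f, coeFn_translation a (translation b f),
    ae_sub (coeFn_translation b f) a] with t h1 h2 h3
  rw [h1, h2, h3, sub_sub]

/-- The representation of `ℤ` on `L²(ℝ)` by translations. -/
def shift : Multiplicative ℤ →* (L2 →L[ℂ] L2) where
  toFun n := (Lp.compMeasurePreservingₗᵢ ℂ (fun x : ℝ => x - (n.toAdd : ℝ))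
    (measurePreserving_sub_right volume _)).toContinuousLinearMap
  map_one' := by
    ext1 f
    exact (congrArg (translation · f) Int.cast_zero).trans (translation_zero f)
  map_mul' m n := by
    ext1 f
    exact (congrArg (translation · f) (Int.cast_add _ _)).trans (translation_add _ _ f)

theorem shift_apply (n : ℤ) (f : L2) : shift (.ofAdd n) f = translation n f := rfl

theorem coeFn_shift (n : ℤ) (f : L2) : shift (.ofAdd n) f =ᵐ[volume] fun t => f (t - n) :=
  coeFn_translation _ f

theorem norm_shift (n : Multiplicative ℤ) (f : L2) : ‖shift n f‖ = ‖f‖ :=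
  LinearIsometry.norm_map _ f

theorem memLp_mul_of_bounded {φ : ℝ → ℂ} (hφ : Measurable φ) (hb : ∀ t, ‖φ t‖ ≤ 1) (f : L2) :
    MemLp (fun t => φ t * f t) 2 volume :=
  (Lp.memLp f).of_le (hφ.aestronglyMeasurable.mul (Lp.aestronglyMeasurable f))
    (Eventually.of_forall fun t => by
      rw [norm_mul]; exact mul_le_of_le_one_left (norm_nonneg _) (hb t))

/-- Multiplication by a measurable function bounded by `1`, as an operator on `L²(ℝ)`. -/
def mulOp (φ : ℝ → ℂ) (hφ : Measurable φ) (hb : ∀ t, ‖φ t‖ ≤ 1) : L2 →L[ℂ] L2 :=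
  have hmem := memLp_mul_of_bounded hφ hb
  LinearMap.mkContinuous
    { toFun := fun f => (hmem f).toLp
      map_add' := fun f g => by
        apply Lp.ext
        filter_upwards [(hmem (f + g)).coeFn_toLp, (hmem f).coeFn_toLp, (hmem g).coeFn_toLp,
          Lp.coeFn_add f g, Lp.coeFn_add (hmem f).toLp (hmem g).toLp] with t h1 h2 h3 h4 h5
        rw [h1, h5, Pi.add_apply, h2, h3, h4, Pi.add_apply, mul_add]
      map_smul' := fun c f => by
        apply Lp.ext
        filter_upwards [(hmem (c • f)).coeFn_toLp, (hmem f).coeFn_toLp,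
          Lp.coeFn_smul c f, Lp.coeFn_smul c (hmem f).toLp] with t h1 h2 h3 h4
        rw [RingHom.id_apply, h1, h4, Pi.smul_apply, h2, h3, Pi.smul_apply, smul_eq_mul,
          smul_eq_mul, mul_left_comm] }
    1 fun f => by
      rw [one_mul]
      refine Lp.norm_le_norm_of_ae_le ?_
      filter_upwards [(hmem f).coeFn_toLp] with t h1
      change ‖(hmem f).toLp _ t‖ ≤ _
      rw [h1, norm_mul]; exact mul_le_of_le_one_left (norm_nonneg _) (hb t)

section MulOp

variable {φ ψ : ℝ → ℂ} {hφ : Measurable φ} {hb : ∀ t, ‖φ t‖ ≤ 1}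
  {hψ : Measurable ψ} {hb' : ∀ t, ‖ψ t‖ ≤ 1}

theorem coeFn_mulOp (f : L2) : mulOp φ hφ hb f =ᵐ[volume] fun t => φ t * f t :=
  MemLp.coeFn_toLp (memLp_mul_of_bounded hφ hb f)

theorem mulOp_comm (f : L2) :
    mulOp φ hφ hb (mulOp ψ hψ hb' f) = mulOp ψ hψ hb' (mulOp φ hφ hb f) := by
  apply Lp.ext
  filter_upwards [coeFn_mulOp (hφ := hφ) (hb := hb) f, coeFn_mulOp (hφ := hψ) (hb := hb') f,
    coeFn_mulOp (hφ := hφ) (hb := hb) (mulOp ψ hψ hb' f),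
    coeFn_mulOp (hφ := hψ) (hb := hb') (mulOp φ hφ hb f)] with t h1 h2 h3 h4
  rw [h3, h4, h1, h2, mul_left_comm]

theorem mulOp_shift {n : ℤ} (h : ∀ t, φ (t - n) = φ t) (f : L2) :
    mulOp φ hφ hb (shift (.ofAdd n) f) = shift (.ofAdd n) (mulOp φ hφ hb f) := by
  apply Lp.ext
  filter_upwards [coeFn_mulOp (hφ := hφ) (hb := hb) (shift (.ofAdd n) f), coeFn_shift n f,
    coeFn_shift n (mulOp φ hφ hb f), ae_sub (coeFn_mulOp (hφ := hφ) (hb := hb) f) n]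
    with t h1 h2 h3 h4
  rw [h1, h2, h3, h4, h]

theorem mulOp_laurentOp (h : ∀ (n : ℤ) t, φ (t - n) = φ t) (p : ℝ[T;T⁻¹]) (f : L2) :
    mulOp φ hφ hb (laurentOp shift p f) = laurentOp shift p (mulOp φ hφ hb f) := by
  rw [laurentOp_apply _ subset_rfl, laurentOp_apply _ subset_rfl, map_sum]
  exact Finset.sum_congr rfl fun n _ => by rw [map_smul, mulOp_shift (h n)]

theorem inner_mulOp_left (hψφ : ∀ t, ψ t = (starRingEnd ℂ) (φ t)) (f g : L2) :
    inner ℂ (mulOp φ hφ hb f) g = inner ℂ f (mulOp ψ hψ hb' g) := by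
  rw [L2.inner_def, L2.inner_def]
  refine integral_congr_ae ?_
  filter_upwards [coeFn_mulOp (hφ := hφ) (hb := hb) f, coeFn_mulOp (hφ := hψ) (hb := hb') g]
    with t h1 h2
  rw [h1, h2, RCLike.inner_apply', RCLike.inner_apply', map_mul, hψφ]
  ring

end MulOp

/-- The character `t ↦ e^{2 π i m t}`. -/
def character (m : ℤ) (t : ℝ) : ℂ := Complex.exp (2 * Real.pi * Complex.I * m * t)

theorem norm_character (m : ℤ) (t : ℝ) : ‖character m t‖ = 1 := by
  have h : (2 * Real.pi * Complex.I * m * t : ℂ) = ((2 * Real.pi * m * t : ℝ) : ℂ) * Complex.I := by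
    push_cast; ring
  rw [character, h, Complex.norm_exp_ofReal_mul_I]

theorem measurable_character (m : ℤ) : Measurable (character m) := by
  unfold character; fun_prop

theorem conj_character (m : ℤ) (t : ℝ) : (starRingEnd ℂ) (character m t) = character (-m) t := by
  rw [character, character, ← Complex.exp_conj]
  simp [Complex.conj_ofNat]

theorem character_sub_intCast (m n : ℤ) (t : ℝ) : character m (t - n) = character m t := by
  have h : (2 * Real.pi * Complex.I * m * ((t - n : ℝ) : ℂ) : ℂ) =
      2 * Real.pi * Complex.I * m * t - ((m * n : ℤ) : ℂ) * (2 * Real.pi * Complex.I) := by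
    push_cast; ring
  rw [character, character, h]
  exact Complex.exp_periodic.sub_int_mul_eq _

/-- Modulation by an integer frequency, as an operator. -/
def modOp (m : ℤ) : L2 →L[ℂ] L2 :=
  mulOp (character m) (measurable_character m) fun t => (norm_character m t).le

theorem whSystem_eq (g : L2) (p : ℤ × ℤ) :
    whSystem g 1 1 p = modOp p.1 (shift (.ofAdd p.2) g) := by
  rw [whSystem, mul_one, mul_one, shift_apply]
  apply Lp.ext
  filter_upwards [(memLp_modulation p.1 (translation p.2 g)).coeFn_toLp,
    coeFn_mulOp (hφ := measurable_character p.1) (hb := fun t => (norm_character p.1 t).le)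
      (translation p.2 g)] with t h1 h2
  rw [modOp, h2, modulation, h1, character]
  simp

/-- The index of the piece of the line which contains `t`. -/
def pieceIndex (t : ℝ) : ℕ := ⌊(Int.fract t)⁻¹⌋₊ - 1

theorem measurable_pieceIndex : Measurable pieceIndex :=
  (measurable_from_nat (f := fun n : ℕ => n - 1)).comp measurable_fract.inv.nat_floor

theorem pieceIndex_sub_intCast (n : ℤ) (t : ℝ) : pieceIndex (t - n) = pieceIndex t := by
  rw [pieceIndex, pieceIndex, Int.fract_sub_intCast]

/-- The `j`-th piece of the line. -/
def piece (j : ℕ) : Set ℝ := pieceIndex ⁻¹' {j}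

theorem measurableSet_piece (j : ℕ) : MeasurableSet (piece j) :=
  measurable_pieceIndex (measurableSet_singleton j)

/-- The restriction of a function to the `j`-th piece of the line. -/
def restrictOp (j : ℕ) : L2 →L[ℂ] L2 :=
  mulOp ((piece j).indicator fun _ => 1) (measurable_const.indicator (measurableSet_piece j))
    fun t => by by_cases h : t ∈ piece j <;> simp [h]

theorem coeFn_restrictOp (j : ℕ) (f : L2) :
    restrictOp j f =ᵐ[volume] fun t => (piece j).indicator (fun _ => (1 : ℂ)) t * f t :=
  coeFn_mulOp f

theorem piece_indicator_sub_intCast (j : ℕ) (n : ℤ) (t : ℝ) :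
    (piece j).indicator (fun _ => (1 : ℂ)) (t - n) = (piece j).indicator (fun _ => 1) t := by
  have h : t - n ∈ piece j ↔ t ∈ piece j := by
    rw [piece, Set.mem_preimage, Set.mem_preimage, pieceIndex_sub_intCast]
  by_cases ht : t ∈ piece j
  · rw [Set.indicator_of_mem ht, Set.indicator_of_mem (h.2 ht)]
  · rw [Set.indicator_of_notMem ht, Set.indicator_of_notMem (mt h.1 ht)]

theorem inner_restrictOp_left (j : ℕ) (f g : L2) :
    inner ℂ (restrictOp j f) g = inner ℂ f (restrictOp j g) :=
  inner_mulOp_left (fun t => by by_cases h : t ∈ piece j <;> simp [h]) f g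

theorem restrictOp_restrictOp (i j : ℕ) (f : L2) :
    restrictOp i (restrictOp j f) = if i = j then restrictOp j f else 0 := by
  apply Lp.ext
  filter_upwards [coeFn_restrictOp i (restrictOp j f), coeFn_restrictOp j f,
    Lp.coeFn_zero ℂ 2 (volume : Measure ℝ)] with t h1 h2 h3
  rw [h1, h2]
  split_ifs with hij
  · subst hij
    rw [h2, ← mul_assoc]
    by_cases h : t ∈ piece i <;> simp [h]
  · rw [h3]
    by_cases h : t ∈ piece j
    · have : t ∉ piece i := fun h' => hij (h'.symm.trans h)
      simp [this]
    · simp [h]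

theorem inner_restrictOp_eq_integral (j : ℕ) (f g : L2) :
    inner ℂ f (restrictOp j g) = ∫ t in piece j, (starRingEnd ℂ) (f t) * g t := by
  rw [L2.inner_def, ← integral_indicator (measurableSet_piece j)]
  refine integral_congr_ae ?_
  filter_upwards [coeFn_restrictOp j g] with t h
  rw [h, RCLike.inner_apply']
  by_cases h : t ∈ piece j <;> simp [h]

theorem integrable_conj_mul (f g : L2) : Integrable (fun t => (starRingEnd ℂ) (f t) * g t) := by
  refine (L2.integrable_inner (𝕜 := ℂ) f g).congr (Eventually.of_forall fun t => ?_)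
  exact RCLike.inner_apply' _ _

theorem iUnion_piece : ⋃ j, piece j = Set.univ :=
  Set.eq_univ_of_forall fun t => Set.mem_iUnion.2 ⟨pieceIndex t, rfl⟩

theorem pairwise_disjoint_piece : Pairwise (Function.onFun Disjoint piece) := fun _ _ hij =>
  Set.disjoint_left.2 fun _ h1 h2 => hij ((Set.mem_singleton_iff.1 h1).symm.trans h2)

theorem hasSum_setIntegral_piece {F : ℝ → ℂ} (hF : Integrable F) :
    HasSum (fun j => ∫ t in piece j, F t) (∫ t, F t) := by
  have := hasSum_integral_iUnion measurableSet_piece pairwise_disjoint_piece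
    (f := F) (μ := volume) hF.integrableOn
  rwa [iUnion_piece, setIntegral_univ] at this

theorem norm_sq_restrictOp (j : ℕ) (f : L2) :
    ((‖restrictOp j f‖ ^ 2 : ℝ) : ℂ) = inner ℂ f (restrictOp j f) := by
  have h := inner_restrictOp_left j f (restrictOp j f)
  rw [restrictOp_restrictOp, if_pos rfl, inner_self_eq_norm_sq_to_K] at h
  rw [← h]; push_cast; rfl

theorem hasSum_norm_sq_restrictOp (f : L2) : HasSum (fun j => ‖restrictOp j f‖ ^ 2) (‖f‖ ^ 2) := by
  have h := hasSum_setIntegral_piece (integrable_conj_mul f f)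
  rw [← Complex.hasSum_ofReal]
  convert h using 1
  · funext j
    rw [norm_sq_restrictOp, inner_restrictOp_eq_integral]
  · rw [Complex.ofReal_pow]
    have h2 := inner_self_eq_norm_sq_to_K (𝕜 := ℂ) f
    rw [L2.inner_def] at h2
    refine h2.symm.trans (integral_congr_ae (Eventually.of_forall fun t => ?_))
    exact RCLike.inner_apply' _ _

theorem restrictOp_laurentOp (j : ℕ) (p : ℝ[T;T⁻¹]) (f : L2) :
    restrictOp j (laurentOp shift p f) = laurentOp shift p (restrictOp j f) :=
  mulOp_laurentOp (piece_indicator_sub_intCast j) p f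

theorem restrictOp_shift (j : ℕ) (n : ℤ) (f : L2) :
    restrictOp j (shift (.ofAdd n) f) = shift (.ofAdd n) (restrictOp j f) :=
  mulOp_shift (piece_indicator_sub_intCast j n) f

theorem modOp_laurentOp (m : ℤ) (p : ℝ[T;T⁻¹]) (f : L2) :
    modOp m (laurentOp shift p f) = laurentOp shift p (modOp m f) :=
  mulOp_laurentOp (character_sub_intCast m) p f

theorem modOp_restrictOp (m : ℤ) (j : ℕ) (f : L2) :
    modOp m (restrictOp j f) = restrictOp j (modOp m f) := mulOp_comm f

theorem shift_laurentOp (n : ℤ) (p : ℝ[T;T⁻¹]) (f : L2) :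
    shift (.ofAdd n) (laurentOp shift p f) = laurentOp shift p (shift (.ofAdd n) f) := by
  rw [← laurentOp_T, ← mul_apply_eq_comp, ← map_mul, mul_comm, map_mul, mul_apply_eq_comp]

/-- A family of functions supported on the different pieces is summable in `L²(ℝ)` if the squares
of the norms are summable. -/
theorem summable_and_hasSum_norm_sq {y : ℕ → L2} (hy : ∀ j, restrictOp j (y j) = y j)
    (hs : Summable fun j => ‖y j‖ ^ 2) :
    Summable y ∧ (∀ j, restrictOp j (∑' i, y i) = y j) ∧
      HasSum (fun j => ‖y j‖ ^ 2) (‖∑' j, y j‖ ^ 2) := by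
  have hortho : OrthogonalFamily ℂ (fun j => (restrictOp j).range)
      fun j => ((restrictOp j).range).subtypeₗᵢ := by
    rintro i j hij ⟨_, u, rfl⟩ ⟨_, v, rfl⟩
    change inner ℂ (restrictOp i u) (restrictOp j v) = 0
    rw [inner_restrictOp_left, restrictOp_restrictOp, if_neg hij, inner_zero_right]
  have hsum : Summable y :=
    (hortho.summable_iff_norm_sq_summable fun j => ⟨y j, y j, hy j⟩).2 hs
  have hres : ∀ j, restrictOp j (∑' i, y i) = y j := by
    intro j
    rw [(restrictOp j).map_tsum hsum, tsum_eq_single j, hy]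
    intro i hi
    rw [← hy i, restrictOp_restrictOp, if_neg hi.symm]
  refine ⟨hsum, hres, ?_⟩
  have h := hasSum_norm_sq_restrictOp (∑' i, y i)
  simpa only [hres] using h

/-! ### The window and the frame property -/

/-- The indicator function of `(0, 1]`. -/
def unitBox : L2 :=
  indicatorConstLp 2 (measurableSet_Ioc : MeasurableSet (Set.Ioc (0 : ℝ) 1)) (by simp) 1

theorem coeFn_shift_unitBox (n : ℤ) : shift (.ofAdd n) unitBox =ᵐ[volume]
    (Set.Ioc (n : ℝ) (n + 1)).indicator fun _ => (1 : ℂ) := by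
  have h : unitBox =ᵐ[volume] (Set.Ioc (0 : ℝ) 1).indicator fun _ => (1 : ℂ) :=
    indicatorConstLp_coeFn
  filter_upwards [coeFn_shift n unitBox, ae_sub h n] with t h1 h2
  rw [h1, h2]
  simp only [Set.indicator_apply, Set.mem_Ioc]
  refine if_congr ?_ rfl rfl
  rw [sub_pos, sub_le_iff_le_add']

theorem inner_shift_unitBox (n : ℤ) (F : L2) :
    inner ℂ (shift (.ofAdd n) unitBox) F = ∫ t in Set.Ioc (n : ℝ) (n + 1), F t := by
  rw [L2.inner_def, ← integral_indicator measurableSet_Ioc]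
  refine integral_congr_ae ?_
  filter_upwards [coeFn_shift_unitBox n] with t h
  rw [RCLike.inner_apply', h]
  by_cases ht : t ∈ Set.Ioc (n : ℝ) (n + 1) <;> simp [ht]

theorem norm_unitBox : ‖unitBox‖ = 1 := by
  rw [unitBox, norm_indicatorConstLp (by norm_num) (by norm_num)]
  simp

theorem inner_shift_unitBox_eq_zero {k l : ℤ} (hkl : k ≠ l) {F : L2}
    (hF : ∀ᵐ t : ℝ, shift (.ofAdd l) unitBox t = 0 → F t = 0) :
    inner ℂ (shift (.ofAdd k) unitBox) F = 0 := by
  rw [inner_shift_unitBox, ← integral_indicator measurableSet_Ioc]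
  refine integral_eq_zero_of_ae ?_
  filter_upwards [coeFn_shift_unitBox l, hF] with t h hF
  by_cases ht : t ∈ Set.Ioc (k : ℝ) (k + 1)
  · rw [Set.indicator_of_mem ht, hF, Pi.zero_apply]
    rw [h, Set.indicator_of_notMem]
    intro ht'
    have h1 : (k : ℝ) < l + 1 := ht.1.trans_le ht'.2
    have h2 : (l : ℝ) < k + 1 := ht'.1.trans_le ht.2
    norm_cast at h1 h2
    omega
  · rw [Set.indicator_of_notMem ht, Pi.zero_apply]

theorem orthonormal_shift_unitBox : Orthonormal ℂ fun k : ℤ => shift (.ofAdd k) unitBox :=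
  ⟨fun k => by rw [norm_shift, norm_unitBox],
    fun _ _ hkl => inner_shift_unitBox_eq_zero hkl (Eventually.of_forall fun _ h => h)⟩

theorem inner_modOp_left (m : ℤ) (f F : L2) :
    inner ℂ (modOp m f) F = inner ℂ f (modOp (-m) F) :=
  inner_mulOp_left (fun t => (conj_character m t).symm) f F

theorem inner_modOp_shift_unitBox (m n : ℤ) (F : L2) :
    inner ℂ (modOp m (shift (.ofAdd n) unitBox)) F =
      fourierCoeffOn (lt_add_one (n : ℝ)) F m := by
  rw [inner_modOp_left, inner_shift_unitBox, fourierCoeffOn_eq_integral,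
    intervalIntegral.integral_of_le (by linarith)]
  have h : (n : ℝ) + 1 - n = 1 := by ring
  rw [h, div_one, one_smul]
  refine integral_congr_ae (ae_restrict_of_ae ?_)
  filter_upwards [coeFn_mulOp (hφ := measurable_character (-m))
    (hb := fun t => (norm_character (-m) t).le) F] with t ht
  rw [modOp, ht, fourier_coe_apply, character]
  simp

/-- Parseval for Fourier series on each interval `(n, n + 1]`, summed over `n`. -/
theorem hasSum_norm_sq_inner_unitBox (F : L2) :
    HasSum (fun p : ℤ × ℤ => ‖inner ℂ (modOp p.1 (shift (.ofAdd p.2) unitBox)) F‖ ^ 2)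
      (‖F‖ ^ 2) := by
  have hint : Integrable fun t => ‖F t‖ ^ 2 := (Lp.memLp F).integrable_norm_pow (by norm_num)
  have h1 : ∀ n : ℤ, HasSum
      (fun m : ℤ => ‖inner ℂ (modOp m (shift (.ofAdd n) unitBox)) F‖ ^ 2)
      (∫ t in Set.Ioc (n : ℝ) (n + 1), ‖F t‖ ^ 2) := by
    intro n
    have := hasSum_sq_fourierCoeffOn (lt_add_one (n : ℝ)) ((Lp.memLp F).restrict _)
    simp_rw [inner_modOp_shift_unitBox]
    rw [intervalIntegral.integral_of_le (by linarith)] at this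
    simpa using this
  have h2 : HasSum (fun n : ℤ => ∫ t in Set.Ioc (n : ℝ) (n + 1), ‖F t‖ ^ 2) (‖F‖ ^ 2) := by
    have h := hasSum_integral_iUnion (fun n : ℤ => measurableSet_Ioc)
      (Set.pairwise_disjoint_Ioc_intCast ℝ) (f := fun t => ‖F t‖ ^ 2) (μ := volume)
      hint.integrableOn
    rw [iUnion_Ioc_intCast, setIntegral_univ] at h
    suffices h' : ‖F‖ ^ 2 = ∫ t, ‖F t‖ ^ 2 by rwa [h']
    have h3 := inner_self_eq_norm_sq_to_K (𝕜 := ℂ) F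
    rw [L2.inner_def] at h3
    rw [← Complex.ofReal_inj, Complex.ofReal_pow]
    refine h3.symm.trans ?_
    rw [← integral_complex_ofReal]
    refine integral_congr_ae (Eventually.of_forall fun t => ?_)
    change inner ℂ (F t) (F t) = _
    rw [inner_self_eq_norm_sq_to_K]
    push_cast; rfl
  have h3 : Summable fun p : ℤ × ℤ =>
      ‖inner ℂ (modOp p.2 (shift (.ofAdd p.1) unitBox)) F‖ ^ 2 := by
    rw [summable_prod_of_nonneg fun _ => sq_nonneg _]
    refine ⟨fun n => (h1 n).summable, ?_⟩
    simp_rw [fun n => (h1 n).tsum_eq]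
    exact h2.summable
  have h4 := h3.hasSum
  rw [h3.tsum_prod] at h4
  simp_rw [fun n => (h1 n).tsum_eq, h2.tsum_eq] at h4
  exact (Equiv.prodComm ℤ ℤ).hasSum_iff.1 h4

theorem norm_generator_invert_le (j : ℕ) (f : L2) :
    ‖laurentOp shift (invert (generator j)) f‖ ≤ 4 * ‖f‖ := by
  rw [norm_laurentOp_invert norm_shift]; exact norm_generator_le norm_shift j f

/-- Uniformly bounded operators, one on each of the mutually orthogonal pieces, assemble to an
operator on `L²(ℝ)`. -/
theorem glue {p : ℕ → ℝ[T;T⁻¹]} (hp : ∀ j (f : L2), ‖laurentOp shift (p j) f‖ ≤ 4 * ‖f‖) (f : L2) :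
    Summable (fun j => laurentOp shift (p j) (restrictOp j f)) ∧
      (∀ j, restrictOp j (∑' i, laurentOp shift (p i) (restrictOp i f)) =
        laurentOp shift (p j) (restrictOp j f)) ∧
      HasSum (fun j => ‖laurentOp shift (p j) (restrictOp j f)‖ ^ 2)
        (‖∑' j, laurentOp shift (p j) (restrictOp j f)‖ ^ 2) := by
  refine summable_and_hasSum_norm_sq (fun j => ?_) ?_
  · rw [restrictOp_laurentOp, restrictOp_restrictOp, if_pos rfl]
  · refine Summable.of_nonneg_of_le (fun _ => sq_nonneg _) (fun j => ?_)
      ((hasSum_norm_sq_restrictOp f).summable.mul_left 16)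
    calc _ ≤ (4 * ‖restrictOp j f‖) ^ 2 := by gcongr; exact hp j _
      _ = _ := by ring

/-- The window: on the `j`-th piece of the line, its values on the translates of the unit interval
are the coefficients of `generator j`. -/
def window : L2 := ∑' j, laurentOp shift (generator j) (restrictOp j unitBox)

/-- The adjoint of the operator which maps `unitBox` to `window`. -/
def analysis (f : L2) : L2 := ∑' j, laurentOp shift (invert (generator j)) (restrictOp j f)

theorem restrictOp_window (j : ℕ) :
    restrictOp j window = laurentOp shift (generator j) (restrictOp j unitBox) :=
  (glue (norm_generator_le norm_shift) unitBox).2.1 j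

theorem hasSum_norm_sq_analysis (f : L2) :
    HasSum (fun j => ‖laurentOp shift (invert (generator j)) (restrictOp j f)‖ ^ 2)
      (‖analysis f‖ ^ 2) :=
  (glue norm_generator_invert_le f).2.2

/-- The operator taking `unitBox` to `window` commutes with integer translations and modulations, so
it can be moved to the other side as its adjoint `analysis`. By Parseval the frame sum is then
`‖analysis f‖²`. -/
theorem inner_whSystem_window (f : L2) (p : ℤ × ℤ) :
    inner ℂ (whSystem window 1 1 p) f =
      inner ℂ (modOp p.1 (shift (.ofAdd p.2) unitBox)) (analysis f) := by
  have hs := (glue (norm_generator_le norm_shift) unitBox).1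
  have hs' : Summable fun j => shift (.ofAdd p.2)
      (laurentOp shift (generator j) (restrictOp j unitBox)) := hs.map (shift (.ofAdd p.2)) (shift (.ofAdd p.2)).continuous
  have h1 : whSystem window 1 1 p = ∑' j, laurentOp shift (generator j)
      (restrictOp j (modOp p.1 (shift (.ofAdd p.2) unitBox))) := by
    rw [whSystem_eq, window, (shift (.ofAdd p.2)).map_tsum hs, (modOp p.1).map_tsum hs']
    refine tsum_congr fun j => ?_
    rw [shift_laurentOp, modOp_laurentOp, ← restrictOp_shift, modOp_restrictOp]
  set e := modOp p.1 (shift (.ofAdd p.2) unitBox)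
  rw [h1, analysis, ← innerSL_apply_apply ℂ e,
    (innerSL ℂ e).map_tsum (glue norm_generator_invert_le f).1, ← innerSLFlip_apply_apply,
    (innerSLFlip ℂ f).map_tsum (glue (norm_generator_le norm_shift) e).1]
  refine tsum_congr fun j => ?_
  rw [innerSLFlip_apply_apply, innerSL_apply_apply, inner_laurentOp_left norm_shift,
    inner_restrictOp_left, restrictOp_laurentOp]

theorem hasSum_norm_sq_inner_whSystem (f : L2) :
    HasSum (fun p => ‖inner ℂ (whSystem window 1 1 p) f‖ ^ 2) (‖analysis f‖ ^ 2) := by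
  simp_rw [inner_whSystem_window]
  exact hasSum_norm_sq_inner_unitBox (analysis f)

theorem identityLHS_window (f : L2) : identityLHS window 1 1 f = ‖analysis f‖ ^ 2 :=
  (hasSum_norm_sq_inner_whSystem f).tsum_eq

theorem isWHFrame_window : IsWHFrame window 1 1 := by
  refine ⟨1 / 4, 16, by norm_num, by norm_num, fun f => ?_⟩
  have h := hasSum_norm_sq_inner_whSystem f
  rw [h.tsum_eq]
  refine ⟨h.summable, ?_, ?_⟩
  · refine hasSum_le (fun j => ?_) ((hasSum_norm_sq_restrictOp f).mul_left (1 / 4))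
      (hasSum_norm_sq_analysis f)
    rw [norm_laurentOp_invert norm_shift]
    calc _ = (1 / 2 * ‖restrictOp j f‖) ^ 2 := by ring
      _ ≤ _ := by gcongr; exact le_norm_generator norm_shift j _
  · refine hasSum_le (fun j => ?_) (hasSum_norm_sq_analysis f)
      ((hasSum_norm_sq_restrictOp f).mul_left 16)
    calc _ ≤ (4 * ‖restrictOp j f‖) ^ 2 := by gcongr; exact norm_generator_invert_le j _
      _ = _ := by ring

/-! ### The correlation functions and the convergence of the series -/

theorem coeFn_laurentOp (p : ℝ[T;T⁻¹]) (f : L2) : laurentOp shift p f =ᵐ[volume]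
    fun t => ∑ k ∈ p.coeff.support, (p.coeff k : ℂ) * f (t - k) := by
  rw [laurentOp_apply _ subset_rfl]
  induction p.coeff.support using Finset.induction_on with
  | empty =>
    simp only [Finset.sum_empty]
    exact Lp.coeFn_zero ℂ 2 (volume : Measure ℝ)
  | insert k S hk ih =>
    rw [Finset.sum_insert hk]
    filter_upwards [ih, Lp.coeFn_add ((p.coeff k : ℂ) • shift (.ofAdd k) f)
      (∑ l ∈ S, (p.coeff l : ℂ) • shift (.ofAdd l) f),
      Lp.coeFn_smul (p.coeff k : ℂ) (shift (.ofAdd k) f), coeFn_shift k f] with t h1 h2 h3 h4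
    rw [h2, Pi.add_apply, h1, h3, Pi.smul_apply, h4, Finset.sum_insert hk, smul_eq_mul]

/-- For `t ∈ (n, n + 1]` one has `⌈t⌉ - 1 = n`, and only the translate of `unitBox` by `n` is
nonzero at `t`. -/
theorem ae_window_eq :
    ∀ᵐ t : ℝ, window t = ((generator (pieceIndex t)).coeff (⌈t⌉ - 1) : ℂ) := by
  have h : ∀ j, restrictOp j window = restrictOp j (laurentOp shift (generator j) unitBox) :=
    fun j => by rw [restrictOp_window, restrictOp_laurentOp]
  have h1 : ∀ᵐ t : ℝ, ∀ j, restrictOp j window t =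
      (piece j).indicator (fun _ => (1 : ℂ)) t * window t :=
    ae_all_iff.2 fun j => coeFn_restrictOp j window
  have h2 : ∀ᵐ t : ℝ, ∀ j, restrictOp j window t =
      (piece j).indicator (fun _ => (1 : ℂ)) t * laurentOp shift (generator j) unitBox t :=
    ae_all_iff.2 fun j => by rw [h]; exact coeFn_restrictOp j _
  have h3 : ∀ᵐ t : ℝ, ∀ j, laurentOp shift (generator j) unitBox t =
      ∑ k ∈ (generator j).coeff.support, ((generator j).coeff k : ℂ) * unitBox (t - k) :=
    ae_all_iff.2 fun j => coeFn_laurentOp _ _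
  have h4 : ∀ᵐ t : ℝ, ∀ k : ℤ, shift (.ofAdd k) unitBox t = unitBox (t - k) :=
    ae_all_iff.2 fun k => coeFn_shift k _
  have h5 : ∀ᵐ t : ℝ, ∀ k : ℤ, shift (.ofAdd k) unitBox t =
      (Set.Ioc (k : ℝ) (k + 1)).indicator (fun _ => (1 : ℂ)) t :=
    ae_all_iff.2 fun k => coeFn_shift_unitBox k
  filter_upwards [h1, h2, h3, h4, h5] with t h1 h2 h3 h4 h5
  have hmem : t ∈ piece (pieceIndex t) := rfl
  have h6 := (h1 (pieceIndex t)).symm.trans (h2 (pieceIndex t))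
  rw [Set.indicator_of_mem hmem, one_mul, one_mul, h3] at h6
  rw [h6, Finset.sum_eq_single (⌈t⌉ - 1)]
  · rw [← h4, h5, Set.indicator_of_mem, mul_one]
    push_cast
    exact ⟨by linarith [Int.ceil_lt_add_one t], by linarith [Int.le_ceil t]⟩
  · intro k _ hk
    rw [← h4, h5, Set.indicator_of_notMem, mul_zero]
    intro ht
    apply hk
    have : ⌈t⌉ = k + 1 := by
      rw [Int.ceil_eq_iff]
      push_cast
      exact ⟨by linarith [ht.1], ht.2⟩
    omega
  · intro hk
    rw [Finsupp.notMem_support_iff] at hk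
    rw [hk]; simp

theorem ae_hasSum_GTerm_window : ∀ᵐ t : ℝ, ∀ k : ℤ,
    HasSum (GTerm window 1 1 k t) ((autocorr (pieceIndex t)).coeff k : ℂ) := by
  have h1 : ∀ᵐ t : ℝ, ∀ n : ℤ, window (t - n) =
      ((generator (pieceIndex (t - n))).coeff (⌈t - n⌉ - 1) : ℂ) :=
    ae_all_iff.2 fun n => ae_sub ae_window_eq n
  filter_upwards [h1] with t h1 k
  set Γ := generator (pieceIndex t) with hΓ
  have h2 : ∀ n : ℤ, window (t - n) = (Γ.coeff (⌈t⌉ - 1 - n) : ℂ) := by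
    intro n
    rw [h1, pieceIndex_sub_intCast, Int.ceil_sub_intCast, sub_right_comm]
  have h3 : HasSum (fun n => ((Γ.coeff n * Γ.coeff (n - k) : ℝ) : ℂ))
      ((autocorr (pieceIndex t)).coeff k : ℂ) := by
    rw [autocorr_coeff_eq_sum, Complex.hasSum_ofReal]
    refine hasSum_sum_of_ne_finset_zero fun n hn => ?_
    rw [Finsupp.notMem_support_iff] at hn
    rw [hn, zero_mul]
  -- The translates `t - n` all lie in one piece, so reindexing by `n ↦ ⌈t⌉ - 1 - n` gives the
  -- finitely supported autocorrelation sum.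
  refine ((Equiv.subLeft (⌈t⌉ - 1)).hasSum_iff.2 h3).congr_fun fun n => ?_
  have h4 : t - n * (1 : ℝ) - k / (1 : ℝ) = t - ((n + k : ℤ) : ℝ) := by push_cast; ring
  rw [GTerm, h4, mul_one, h2, h2, Complex.conj_ofReal, Function.comp_apply, Equiv.subLeft_apply,
    Complex.ofReal_mul, sub_sub _ n k]

theorem ae_G_window : ∀ᵐ t : ℝ, ∀ k : ℤ,
    G window 1 1 k t = ((autocorr (pieceIndex t)).coeff k : ℂ) := by
  filter_upwards [ae_hasSum_GTerm_window] with t h k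
  exact (h k).tsum_eq

theorem identityIntegrand_window_ae (f : L2) (k : ℤ) :
    identityIntegrand window 1 1 f k =ᵐ[volume] fun t =>
      ((autocorr (pieceIndex t)).coeff k : ℂ) * ((starRingEnd ℂ) (f t) * shift (.ofAdd k) f t) := by
  filter_upwards [ae_G_window, coeFn_shift k f] with t h1 h2
  rw [identityIntegrand, h1, h2, div_one, mul_comm]

theorem integrable_identityIntegrand_window (f : L2) (k : ℤ) :
    Integrable (identityIntegrand window 1 1 f k) := by
  refine Integrable.congr ?_ (identityIntegrand_window_ae f k).symm
  refine (integrable_conj_mul f (shift (.ofAdd k) f)).bdd_mul (c := 11) ?_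
    (Eventually.of_forall fun t => ?_)
  · exact ((measurable_from_nat (f := fun j => ((autocorr j).coeff k : ℂ))).comp
      measurable_pieceIndex).aestronglyMeasurable
  · rw [Complex.norm_real, Real.norm_eq_abs]
    exact abs_autocorr_coeff_le norm_shift orthonormal_shift_unitBox _ k

theorem hasSum_identityRHSTerm_window (f : L2) (k : ℤ) :
    HasSum (fun j => ((autocorr j).coeff k : ℂ) *
      inner ℂ (restrictOp j f) (shift (.ofAdd k) (restrictOp j f)))
      (identityRHSTerm window 1 1 f k) := by
  have h := hasSum_setIntegral_piece (integrable_identityIntegrand_window f k)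
  rw [identityRHSTerm, Complex.ofReal_one, div_one, one_mul]
  refine h.congr_fun fun j => ?_
  rw [← restrictOp_shift, inner_restrictOp_left, restrictOp_restrictOp, if_pos rfl,
    inner_restrictOp_eq_integral, ← integral_const_mul]
  refine setIntegral_congr_ae (measurableSet_piece j) ?_
  filter_upwards [identityIntegrand_window_ae f k] with t ht hj
  have hj' : pieceIndex t = j := hj
  rw [ht, hj']

theorem tendsto_identityRHS_window (f : L2) :
    Tendsto (fun KL : ℤ × ℤ => ∑ k ∈ Finset.Icc (-KL.2) KL.1, identityRHSTerm window 1 1 f k)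
      (atTop ×ˢ atTop) (𝓝 ((identityLHS window 1 1 f : ℝ) : ℂ)) := by
  have h1 : ∀ KL : ℤ × ℤ, ∑ k ∈ Finset.Icc (-KL.2) KL.1, identityRHSTerm window 1 1 f k =
      ∑' j, ∑ k ∈ Finset.Icc (-KL.2) KL.1, ((autocorr j).coeff k : ℂ) *
        inner ℂ (restrictOp j f) (shift (.ofAdd k) (restrictOp j f)) := fun KL =>
    (hasSum_sum fun k _ => hasSum_identityRHSTerm_window f k).tsum_eq.symm
  have h2 : ((identityLHS window 1 1 f : ℝ) : ℂ) = ∑' j,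
      ((‖laurentOp shift (invert (generator j)) (restrictOp j f)‖ ^ 2 : ℝ) : ℂ) := by
    rw [identityLHS_window, ← (hasSum_norm_sq_analysis f).tsum_eq, Complex.ofReal_tsum]
  simp_rw [h1]
  rw [h2]
  -- The limit is taken piece by piece, with dominating sequence `31 ‖f_j‖²`. For fixed `j` the
  -- partial sums are eventually constant, once the interval contains the support of `autocorr j`.
  refine tendsto_tsum_of_dominated_convergence
    ((hasSum_norm_sq_restrictOp f).summable.mul_left 31) (fun j => ?_)
    (Eventually.of_forall fun KL j =>
      norm_sum_Icc_autocorr_le norm_shift orthonormal_shift_unitBox j _ _ _)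
  obtain ⟨a, ha⟩ := (autocorr j).coeff.support.bddBelow
  obtain ⟨b, hb⟩ := (autocorr j).coeff.support.bddAbove
  refine tendsto_const_nhds.congr' ?_
  filter_upwards [prod_mem_prod (eventually_ge_atTop b) (eventually_ge_atTop (-a))] with KL hKL
  refine (sum_autocorr_mul_inner norm_shift j _ fun k hk => ?_).symm
  rw [Finset.mem_Icc]
  exact ⟨(neg_le.1 hKL.2).trans (ha hk), (hb hk).trans hKL.1⟩

/-! ### A function for which the series does not converge unconditionally -/

theorem Ioo_subset_piece (j : ℕ) :
    Set.Ioo (1 / ((j : ℝ) + 2)) (1 / ((j : ℝ) + 1)) ⊆ piece j ∩ Set.Ioc 0 1 := by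
  intro t ht
  have hj : (0 : ℝ) ≤ j := Nat.cast_nonneg j
  have h0 : 0 < t := lt_trans (by positivity) ht.1
  have h1 : t < 1 := ht.2.trans_le (by rw [div_le_one (by positivity)]; linarith)
  refine ⟨?_, h0, h1.le⟩
  have hf : Int.fract t = t := Int.fract_eq_self.2 ⟨h0.le, h1⟩
  have h2 : (j : ℝ) + 1 ≤ t⁻¹ := by
    rw [le_inv_comm₀ (by positivity) h0, ← one_div]; exact ht.2.le
  have h3 : t⁻¹ < (j : ℝ) + 2 := by
    rw [inv_lt_comm₀ h0 (by positivity), ← one_div]; exact ht.1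
  have h4 : ⌊t⁻¹⌋₊ = j + 1 := by
    rw [Nat.floor_eq_iff (by positivity)]
    push_cast
    exact ⟨h2, by linarith⟩
  rw [piece, Set.mem_preimage, pieceIndex, hf, h4]
  rfl

/-- Each piece meets the unit interval in positive measure; this allows the test functions to be
normalised. -/
theorem restrictOp_unitBox_ne_zero (j : ℕ) : restrictOp j unitBox ≠ 0 := by
  intro h
  have h1 : ∀ᵐ t : ℝ, t ∉ Set.Ioo (1 / ((j : ℝ) + 2)) (1 / ((j : ℝ) + 1)) := by
    have h0 := coeFn_shift_unitBox 0
    rw [ofAdd_zero, map_one] at h0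
    filter_upwards [coeFn_restrictOp j unitBox, h0, Lp.coeFn_zero ℂ 2 (volume : Measure ℝ)]
      with t h1 h2 h3 ht
    rw [_root_.one_apply_eq_self] at h2
    obtain ⟨h4, h5⟩ := Ioo_subset_piece j ht
    rw [h, h3, h2, Set.indicator_of_mem h4, Set.indicator_of_mem (by simpa using h5)] at h1
    simp at h1
  rw [ae_iff] at h1
  simp only [not_not, Set.ofPred_mem_eq, Real.volume_Ioo, ENNReal.ofReal_eq_zero] at h1
  have h2 : 1 / ((j : ℝ) + 2) < 1 / ((j : ℝ) + 1) := by
    apply one_div_lt_one_div_of_lt <;> [positivity; linarith]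
  linarith

/-- The sum of the translates by `0, …, N - 1` of the restriction of `unitBox` to the `j`-th
piece. -/
def comb (j N : ℕ) : L2 := ∑ n ∈ Finset.range N, shift (.ofAdd (n : ℤ)) (restrictOp j unitBox)

theorem restrictOp_comb (j N : ℕ) : restrictOp j (comb j N) = comb j N := by
  rw [comb, map_sum]
  exact Finset.sum_congr rfl fun n _ => by
    rw [restrictOp_shift, restrictOp_restrictOp, if_pos rfl]

theorem inner_shift_restrictOp_unitBox (j : ℕ) (k l : ℤ) :
    inner ℂ (shift (.ofAdd k) (restrictOp j unitBox)) (shift (.ofAdd l) (restrictOp j unitBox)) =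
      if k = l then ((‖restrictOp j unitBox‖ ^ 2 : ℝ) : ℂ) else 0 := by
  split_ifs with h
  · rw [h, inner_self_eq_norm_sq_to_K, norm_shift]; push_cast; rfl
  · rw [← restrictOp_shift, inner_restrictOp_left, restrictOp_shift, restrictOp_restrictOp,
      if_pos rfl, ← restrictOp_shift]
    refine inner_shift_unitBox_eq_zero h ?_
    filter_upwards [coeFn_restrictOp j (shift (.ofAdd l) unitBox)] with t h1 h2
    rw [h1, h2, mul_zero]

/-- The inner product counts overlapping teeth; truncated subtraction gives the correct count `0`
when `k ≥ N`. -/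
theorem inner_comb_shift (j N k : ℕ) : inner ℂ (comb j N) (shift (.ofAdd (k : ℤ)) (comb j N)) =
    (((N - k : ℕ) * ‖restrictOp j unitBox‖ ^ 2 : ℝ) : ℂ) := by
  rw [comb, map_sum, inner_sum]
  have h : ∀ m ∈ Finset.range N, inner ℂ
      (∑ n ∈ Finset.range N, shift (.ofAdd (n : ℤ)) (restrictOp j unitBox))
      (shift (.ofAdd (k : ℤ)) (shift (.ofAdd (m : ℤ)) (restrictOp j unitBox))) =
      if m ∈ Finset.range (N - k) then ((‖restrictOp j unitBox‖ ^ 2 : ℝ) : ℂ) else 0 := by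
    intro m _
    rw [← mul_apply_eq_comp, ← map_mul, ← ofAdd_add, sum_inner]
    simp_rw [inner_shift_restrictOp_unitBox, ← Nat.cast_add, Nat.cast_inj]
    rw [Finset.sum_ite_eq']
    refine if_congr ?_ rfl rfl
    rw [Finset.mem_range, Finset.mem_range]
    omega
  rw [Finset.sum_congr rfl h, Finset.sum_ite_mem, Finset.sum_const, nsmul_eq_mul,
    Finset.inter_eq_right.2 (Finset.range_subset_range.2 (Nat.sub_le _ _)), Finset.card_range]
  push_cast
  rfl

theorem norm_sq_comb (j N : ℕ) : ‖comb j N‖ ^ 2 = N * ‖restrictOp j unitBox‖ ^ 2 := by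
  have h := inner_comb_shift j N 0
  rw [Nat.cast_zero, ofAdd_zero, map_one, one_apply_eq_self, inner_self_eq_norm_sq_to_K] at h
  rw [← Complex.ofReal_inj, Complex.ofReal_pow]
  exact h

/-- A function on the `j`-th piece with squared norm `(8 / 9) ^ j` which is almost invariant under
translations by less than `2 ^ (j + 1)`. -/
def testPiece (j : ℕ) : L2 :=
  ((Real.sqrt ((8 / 9) ^ j) / ‖comb j (4 * 2 ^ j)‖ : ℝ) : ℂ) • comb j (4 * 2 ^ j)

theorem norm_comb_pos (j : ℕ) : 0 < ‖comb j (4 * 2 ^ j)‖ := by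
  have h1 := norm_pos_iff.2 (restrictOp_unitBox_ne_zero j)
  have h2 := norm_sq_comb j (4 * 2 ^ j)
  have h3 : 0 < ‖comb j (4 * 2 ^ j)‖ ^ 2 := by rw [h2]; positivity
  exact (norm_nonneg _).lt_of_ne fun h => by rw [← h] at h3; simp at h3

theorem norm_sq_testPiece (j : ℕ) : ‖testPiece j‖ ^ 2 = (8 / 9) ^ j := by
  have h := norm_comb_pos j
  rw [testPiece, norm_smul, Complex.norm_real, Real.norm_eq_abs, abs_of_nonneg (by positivity),
    div_mul_cancel₀ _ h.ne', Real.sq_sqrt (by positivity)]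

/-- Of the `4 · 2^j` teeth, more than half still overlap after a shift by less than `2 · 2^j`. -/
theorem le_norm_inner_testPiece (j k : ℕ) (hk : k < 2 ^ (j + 1)) :
    1 / 2 * (8 / 9 : ℝ) ^ j ≤ ‖inner ℂ (testPiece j) (shift (.ofAdd (k : ℤ)) (testPiece j))‖ := by
  have h := norm_comb_pos j
  rw [testPiece, map_smul, inner_smul_left, inner_smul_right, Complex.conj_ofReal, inner_comb_shift,
    ← Complex.ofReal_mul, ← Complex.ofReal_mul, Complex.norm_real]
  refine le_trans ?_ (le_abs_self _)
  have h1 := norm_sq_comb j (4 * 2 ^ j)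
  have h2 : (2 * 2 ^ j : ℝ) ≤ ((4 * 2 ^ j - k : ℕ) : ℝ) := by
    have : 2 * 2 ^ j ≤ 4 * 2 ^ j - k := by rw [pow_succ] at hk; omega
    exact_mod_cast this
  have h3 : 1 / 2 * ‖comb j (4 * 2 ^ j)‖ ^ 2 ≤
      ((4 * 2 ^ j - k : ℕ) : ℝ) * ‖restrictOp j unitBox‖ ^ 2 := by
    rw [h1]
    push_cast
    calc _ = 2 * 2 ^ j * ‖restrictOp j unitBox‖ ^ 2 := by ring
      _ ≤ _ := by gcongr
  have h4 : (8 / 9 : ℝ) ^ j = Real.sqrt ((8 / 9) ^ j) * Real.sqrt ((8 / 9) ^ j) :=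
    (Real.mul_self_sqrt (by positivity)).symm
  set s := Real.sqrt ((8 / 9) ^ j)
  calc 1 / 2 * (8 / 9 : ℝ) ^ j
      = s / ‖comb j (4 * 2 ^ j)‖ * (s / ‖comb j (4 * 2 ^ j)‖ *
        (1 / 2 * ‖comb j (4 * 2 ^ j)‖ ^ 2)) := by rw [h4]; field_simp
    _ ≤ _ := by gcongr

/-- The function for which the series does not converge unconditionally. -/
def testFunction : L2 := ∑' j, testPiece j

theorem restrictOp_testFunction (j : ℕ) : restrictOp j testFunction = testPiece j := by
  refine (summable_and_hasSum_norm_sq (fun j => ?_) ?_).2.1 j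
  · rw [testPiece, map_smul, restrictOp_comb]
  · simp_rw [norm_sq_testPiece]
    exact summable_geometric_of_lt_one (by norm_num) (by norm_num)

/-- The blocks occupy disjoint dyadic ranges of positive degrees, so only block `i` has a
coefficient at `k`, and no block has one at `-k`. -/
theorem hasSum_error (f : L2) (k : ℤ) (i : ℕ) (hk : 2 ^ i ≤ k) (hk' : k < 2 ^ (i + 1)) :
    HasSum (fun j => ((blockAutocorr j).coeff k : ℂ) *
      inner ℂ (restrictOp j f) (shift (.ofAdd k) (restrictOp j f)))
      (identityRHSTerm window 1 1 f k - 2 * ((shiftedBlock i).coeff k : ℂ) *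
        inner ℂ (restrictOp i f) (shift (.ofAdd k) (restrictOp i f))) := by
  have hpos : ∀ j : ℕ, (0 : ℤ) < 2 ^ j := fun j => by positivity
  have h0 := hpos i
  have h1 : ∀ j ≠ i, (shiftedBlock j).coeff k = 0 := by
    intro j hj
    refine shiftedBlock_coeff_eq_zero j k ?_
    rcases lt_or_gt_of_ne hj with h | h
    · right; exact (pow_le_pow_right₀ (by norm_num) h).trans hk
    · left; exact hk'.trans_le (pow_le_pow_right₀ (by norm_num) h)
  have h2 : HasSum (fun j => 2 * ((shiftedBlock j).coeff k : ℂ) *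
      inner ℂ (restrictOp j f) (shift (.ofAdd k) (restrictOp j f)))
      (2 * ((shiftedBlock i).coeff k : ℂ) *
        inner ℂ (restrictOp i f) (shift (.ofAdd k) (restrictOp i f))) :=
    hasSum_single i fun j hj => by rw [h1 j hj]; simp
  refine ((hasSum_identityRHSTerm_window f k).sub h2).congr_fun fun j => ?_
  have h3 : (shiftedBlock j).coeff (-k) = 0 :=
    shiftedBlock_coeff_eq_zero j (-k) (Or.inl (by have := hpos j; omega))
  rw [autocorr_coeff, h3, if_neg (by omega)]
  push_cast
  ring

/-- Interchanging the sums over `k` and `j`, the uniform `ℓ¹` bound gives at most `3 ∑_j ‖f_j‖²`. -/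
theorem summable_error (f : L2) : Summable fun k : ℤ => ‖∑' j, ((blockAutocorr j).coeff k : ℂ) *
    inner ℂ (restrictOp j f) (shift (.ofAdd k) (restrictOp j f))‖ := by
  have hsum := (hasSum_norm_sq_restrictOp f).summable
  have hB := sum_abs_blockAutocorr_le norm_shift orthonormal_shift_unitBox
  have hs : ∀ k : ℤ, Summable fun j => |(blockAutocorr j).coeff k| * ‖restrictOp j f‖ ^ 2 := by
    intro k
    refine Summable.of_nonneg_of_le (fun j => by positivity) (fun j => ?_) (hsum.mul_left 3)
    have := hB j {k}
    rw [Finset.sum_singleton] at this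
    gcongr
  refine summable_of_sum_le (c := ∑' j, 3 * ‖restrictOp j f‖ ^ 2) (fun k => norm_nonneg _)
    fun S => ?_
  calc _ ≤ ∑ k ∈ S, ∑' j, |(blockAutocorr j).coeff k| * ‖restrictOp j f‖ ^ 2 := by
        refine Finset.sum_le_sum fun k _ => tsum_of_norm_bounded (hs k).hasSum fun j => ?_
        rw [norm_mul, Complex.norm_real, Real.norm_eq_abs]
        gcongr
        exact (norm_inner_le_norm _ _).trans (by rw [norm_shift, sq])
    _ = ∑' j, ∑ k ∈ S, |(blockAutocorr j).coeff k| * ‖restrictOp j f‖ ^ 2 :=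
        (Summable.tsum_finsetSum fun k _ => hs k).symm
    _ ≤ _ := by
        refine Summable.tsum_le_tsum (fun j => ?_) (summable_sum fun k _ => hs k) (hsum.mul_left 3)
        rw [← Finset.sum_mul]
        gcongr
        exact hB j S

theorem not_summable_identityRHS_testFunction :
    ¬ Summable fun k : ℤ => identityRHSTerm window 1 1 testFunction k := by
  intro hs
  set E : ℤ → ℂ := fun k => ∑' j, ((blockAutocorr j).coeff k : ℂ) *
    inner ℂ (restrictOp j testFunction) (shift (.ofAdd k) (restrictOp j testFunction)) with hE
  -- In `ℂ` unconditional convergence is absolute, so the main terms would be absolutely summable; a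
  -- dyadic block beyond the Cauchy set `S` will contradict this.
  have h1 : Summable fun k : ℤ => ‖identityRHSTerm window 1 1 testFunction k - E k‖ :=
    (hs.sub (summable_error testFunction).of_norm).norm
  obtain ⟨S, hS⟩ := summable_iff_vanishing_norm.1 h1 1 one_pos
  obtain ⟨b, hb⟩ := S.bddAbove
  obtain ⟨i, hi⟩ := pow_unbounded_of_one_lt b (by norm_num : (1 : ℤ) < 2)
  set B := (Finset.Ico (2 ^ i) (2 ^ (i + 1)) : Finset ℕ).map (Nat.castEmbedding : ℕ ↪ ℤ) with hBdef
  have hdisj : Disjoint B S := by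
    rw [Finset.disjoint_left]
    intro k hk hkS
    rw [hBdef, Finset.mem_map] at hk
    obtain ⟨n, hn, rfl⟩ := hk
    have h2 : (2 : ℤ) ^ i ≤ n := by exact_mod_cast (Finset.mem_Ico.1 hn).1
    have h3 : (Nat.castEmbedding n : ℤ) ≤ b := hb hkS
    rw [Nat.castEmbedding_apply] at h3
    omega
  have h2 := hS B hdisj
  rw [Real.norm_of_nonneg (Finset.sum_nonneg fun _ _ => norm_nonneg _), hBdef,
    Finset.sum_map] at h2
  have h3 : ∀ n ∈ Finset.Ico (2 ^ i) (2 ^ (i + 1)), (9 / 16 : ℝ) ^ i * (8 / 9) ^ i ≤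
      ‖identityRHSTerm window 1 1 testFunction (Nat.castEmbedding n) - E (Nat.castEmbedding n)‖ := by
    intro n hn
    rw [Finset.mem_Ico] at hn
    have hn1 : (2 : ℤ) ^ i ≤ n := by exact_mod_cast hn.1
    have hn2 : (n : ℤ) < 2 ^ (i + 1) := by exact_mod_cast hn.2
    rw [Nat.castEmbedding_apply, hE]
    dsimp only
    rw [(hasSum_error testFunction n i hn1 hn2).tsum_eq, sub_sub_cancel, norm_mul, norm_mul,
      Complex.norm_real, Real.norm_eq_abs, abs_shiftedBlock_coeff i n hn1 hn2,
      Complex.norm_ofNat, restrictOp_testFunction]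
    have h4 := le_norm_inner_testPiece i n hn.2
    calc _ = 2 * (9 / 16 : ℝ) ^ i * (1 / 2 * (8 / 9) ^ i) := by ring
      _ ≤ _ := by gcongr
  have h4 := Finset.card_nsmul_le_sum _ _ _ h3
  -- The ratios are matched so that `2 · (9/16) · (8/9) = 1`.
  have h5 : (Finset.Ico (2 ^ i) (2 ^ (i + 1))).card • ((9 / 16 : ℝ) ^ i * (8 / 9) ^ i) = 1 := by
    have : 2 ^ (i + 1) - 2 ^ i = 2 ^ i := by rw [pow_succ]; omega
    rw [Nat.card_Ico, this, nsmul_eq_mul, Nat.cast_pow, ← mul_pow, ← mul_pow]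
    norm_num
  linarith

end WeylHeisenberg

end

/-- There is a WH-frame `(g, 1, 1)` for which the series on the right side of the WH-frame identity
converges (as `K, L → ∞` independently) to the left side for every `f ∈ L²(ℝ)`, but for some
`h ∈ L²(ℝ)` does not converge unconditionally. The second and third conjuncts say that the
series `G_k` and the integrals in the identity really exist. -/
theorem mainTheorem9 :
    ∃ g : WeylHeisenberg.L2,
      WeylHeisenberg.IsWHFrame g 1 1 ∧
      (∀ k : ℤ, ∀ᵐ t : ℝ, Summable (WeylHeisenberg.GTerm g 1 1 k t)) ∧
      (∀ (f : WeylHeisenberg.L2) (k : ℤ),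
        Integrable (WeylHeisenberg.identityIntegrand g 1 1 f k) volume) ∧
      (∀ f : WeylHeisenberg.L2,
        Tendsto
          (fun KL : ℤ × ℤ =>
            ∑ k ∈ Finset.Icc (-KL.2) KL.1, WeylHeisenberg.identityRHSTerm g 1 1 f k)
          (atTop ×ˢ atTop)
          (𝓝 ((WeylHeisenberg.identityLHS g 1 1 f : ℝ) : ℂ))) ∧
      ∃ h : WeylHeisenberg.L2,
        ¬ Summable (fun k : ℤ => WeylHeisenberg.identityRHSTerm g 1 1 h k) :=
  ⟨WeylHeisenberg.window, WeylHeisenberg.isWHFrame_window,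
    fun k => WeylHeisenberg.ae_hasSum_GTerm_window.mono fun _ h => (h k).summable,
    WeylHeisenberg.integrable_identityIntegrand_window,
    WeylHeisenberg.tendsto_identityRHS_window,
    WeylHeisenberg.testFunction, WeylHeisenberg.not_summable_identityRHS_testFunction⟩
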